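/- **Setting.** Let $m\ge 1$, outcome values $0=\pi_1<\dots<\pi_m\le 1$, and an effort set $[0,E]$ with $E>0$. An agent type $\theta$ consists of an increasing convex cost function $c:[0,E]\to\mathbb R$ with $c(0)=0$ and outcome probabilities $f_1(a),\dots,f_m(a)\ge 0$ with $\sum_j f_j(a)=1$ for $a\in[0,E]$. A contract is a vector $s\in[0,1]^m$ with $s_1\le\dots\le s_m$. Under $s$, the agent takes an action $a\in[0,E]$ that maximizes $\sum_j s_jf_j(a)-c(a)$ (ties broken in favour of the principal), and $u_P(s\mid\theta)$ is the resulting expected principal utility $\sum_j(\pi_j-s_j)f_j(a)$. Let $\mu<\lambda$ and $L$ be real numbers, and assume that every type satisfies: $c$ and all $G_j:=\sum_{k\ge j}f_k$ are twice differentiable on $[0,E]$, with $G_j''\le\mu$, $c''\ge\lambda$ and $|G_j'|\le L$ on $[0,E]$. In each round $t=1,\dots,T$ the principal posts a contract $s_t$ that depends only on the outcomes observed in rounds $1,\dots,t-1$; an agent whose type $\theta_t$ is drawn i.i.d. from a distribution $\mathcal D$ unknown to the principal responds to $s_t$; and the principal observes the realized outcome. Write $\bar u(s)=\mathbb E_{\theta\sim\mathcal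 D}[u_P(s\mid\theta)]$, $\Delta(s)=\max_{s'}\bar u(s')-\bar u(s)$, and let the expected regret be $$\mathbb E\Big[T\max_s\bar u(s)-\sum_{t=1}^T\bar u(s_t)\Big].$$ Let $K=\frac{4L^2}{\lambda-\mu}+2$ and equip the contracts with the distance $K\|s-s'\|_1$. For $c_0>0$, the zooming dimension with multiplier $c_0$ is the infimum of all $d\ge 0$ such that for every $r\in(0,1]$ the set $\{s: r<\Delta(s)\le 2r\}$ can be covered by at most $c_0r^{-d}$ sets of diameter at most $r/8$ (it is finite if such a $d$ exists). **Proposition.** There is an absolute constant $C>0$ such that for all $m,\pi,E,\lambda,\mu,L$ as above and every $T\ge 2$ there is a policy for the principal, not depending on $\mathcal D$, with the following property. For every distribution $\mathcal D$ over types satisfying the assumptions, $u_P(s\mid\theta)$ is $\mathcal D$-integrable in $\theta$ for each contract $s$, and $|\bar u(s)-\bar u(s')|\le K\|s-s'\|_1$ for all contracts $s,s'$; the zooming dimension with multiplier $c_0$ is finite for some $c_0>0$; and for every $c_0>0$ for which the zooming dimension $z$ with multiplier $c_0$ is finite, the policy has expected regret at most $$C\,(c_0\log T)^{1/(z+2)}\,T^{(z+1)/(z+2)}=\widetilde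 O\big(T^{(z+1)/(z+2)}\big).$$ -/

import Mathlib

open MeasureTheory Set

noncomputable section

namespace ContractDesign

/-! ### The one-round principal-agent model -/

/-- An agent type in the one-dimensional effort model with effort set `[0, E]` and `m` outcome
levels: a cost function `cost` (increasing, convex, `cost 0 = 0`) and a production technology,
`prob a j` being the probability of outcome level `j` under effort `a`.
Values outside `[0, E]` are irrelevant. -/
structure AgentType (m : ℕ) (E : ℝ) where
  cost : ℝ → ℝ
  prob : ℝ → Fin m → ℝ
  cost_zero : cost 0 = 0
  cost_mono : MonotoneOn cost (Icc 0 E)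
  cost_convex : ConvexOn ℝ (Icc 0 E) cost
  prob_nonneg : ∀ a ∈ Icc 0 E, ∀ j, 0 ≤ prob a j
  prob_sum : ∀ a ∈ Icc 0 E, ∑ j, prob a j = 1

/-- Contracts `s` with nonnegative payments that are monotone (`s_j ≤ s_{j+1}`) and bounded
(`s_j ≤ 1`). -/
def Contract (m : ℕ) : Type :=
  {s : Fin m → ℝ // (∀ j, 0 ≤ s j) ∧ Monotone s ∧ ∀ j, s j ≤ 1}

/-- The payment of the contract `s` at outcome level `j`. -/
def Contract.pay {m : ℕ} (s : Contract m) (j : Fin m) : ℝ := s.1 j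

namespace AgentType

variable {m : ℕ} {E : ℝ}

/-- Complementary distribution function `G_j(a) = ∑_{k ≥ j} f_k(a)`. -/
def ccdf (θ : AgentType m E) (j : Fin m) (a : ℝ) : ℝ := ∑ k ∈ Finset.Ici j, θ.prob a k

/-- Expected utility `u_A(a; s)` of the agent. -/
def agentUtility (θ : AgentType m E) (s : Contract m) (a : ℝ) : ℝ :=
  ∑ j, s.pay j * θ.prob a j - θ.cost a

/-- Expected utility `u_P(a; s)` of the principal when outcome level `j` is worth `π j`. -/
def principalUtilityAt (θ : AgentType m E) (π : Fin m → ℝ) (s : Contract m) (a : ℝ) : ℝ :=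
  ∑ j, (π j - s.pay j) * θ.prob a j

/-- The incentive compatible actions under `s`. -/
def incentiveCompatible (θ : AgentType m E) (s : Contract m) : Set ℝ :=
  {a | a ∈ Icc 0 E ∧ ∀ a' ∈ Icc 0 E, θ.agentUtility s a' ≤ θ.agentUtility s a}

/-- `u_P(s | θ)`: the maximum of `u_P(a; s)` over the incentive compatible actions `a`. -/
def principalUtility (θ : AgentType m E) (π : Fin m → ℝ) (s : Contract m) : ℝ :=
  sSup (θ.principalUtilityAt π s '' θ.incentiveCompatible s)

open Classical in
/-- The action taken by the agent under `s`: an incentive compatible action, ties (if any) being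
broken in favour of the principal. -/
def response (θ : AgentType m E) (π : Fin m → ℝ) (s : Contract m) : ℝ :=
  if h : ∃ a ∈ θ.incentiveCompatible s,
      ∀ b ∈ θ.incentiveCompatible s, θ.principalUtilityAt π s b ≤ θ.principalUtilityAt π s a
  then h.choose else 0

/-- The continuity assumptions on a type with parameters `lam`, `mu`, `L`:
`c` and all `G_j` are twice differentiable on `[0, E]` (one-sidedly at the end points), and
`G_j'' ≤ mu`, `lam ≤ c''`, `|G_j'| ≤ L` on `[0, E]`. -/
structure IsRegular (θ : AgentType m E) (lam mu L : ℝ) : Prop where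
  cost_diff : DifferentiableOn ℝ θ.cost (Icc 0 E)
  cost_diff_two : DifferentiableOn ℝ (derivWithin θ.cost (Icc 0 E)) (Icc 0 E)
  ccdf_diff : ∀ j, DifferentiableOn ℝ (θ.ccdf j) (Icc 0 E)
  ccdf_diff_two : ∀ j, DifferentiableOn ℝ (derivWithin (θ.ccdf j) (Icc 0 E)) (Icc 0 E)
  le_cost : ∀ a ∈ Icc 0 E, lam ≤ derivWithin (derivWithin θ.cost (Icc 0 E)) (Icc 0 E) a
  ccdf_le : ∀ j, ∀ a ∈ Icc 0 E,
    derivWithin (derivWithin (θ.ccdf j) (Icc 0 E)) (Icc 0 E) a ≤ mu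
  ccdf_lipschitz : ∀ j, ∀ a ∈ Icc 0 E, |derivWithin (θ.ccdf j) (Icc 0 E) a| ≤ L

end AgentType

/-- The weighted `ℓ¹` distance `K * ‖s - s'‖₁` on contracts. -/
def contractDist {m : ℕ} (K : ℝ) (s s' : Contract m) : ℝ := K * ∑ j, |s.pay j - s'.pay j|

/-- The Lipschitz constant `4 L² / (lam - mu) + 2`. -/
def lipConst (lam mu L : ℝ) : ℝ := 4 * L ^ 2 / (lam - mu) + 2

/-! ### Zooming dimension of a bandit instance with arms `X`, mean payoff `v`, distance `dist` -/

section Zooming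

variable {X : Type*}

/-- The set `A` can be covered by `n` sets of diameter at most `δ`. -/
def CoverableBy (dist : X → X → ℝ) (A : Set X) (δ : ℝ) (n : ℕ) : Prop :=
  ∃ U : Fin n → Set X, A ⊆ ⋃ i, U i ∧ ∀ i, ∀ x ∈ U i, ∀ y ∈ U i, dist x y ≤ δ

/-- By how much the arm `x` falls short of the optimal mean payoff. -/
def gap (v : X → ℝ) (x : X) : ℝ := (⨆ x', v x') - v x

/-- The arms whose payoff falls short of the optimum by an amount between `r` and `2 r`. -/
def gapShell (v : X → ℝ) (r : ℝ) : Set X := {x | r < gap v x ∧ gap v x ≤ 2 * r}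

/-- The exponents `d ≥ 0` such that for all `r ∈ (0, 1]` at most `c * r ^ (-d)` sets of diameter
`r / 8` suffice to cover the arms with gap between `r` and `2 r`. -/
def zoomingExponents (dist : X → X → ℝ) (v : X → ℝ) (c : ℝ) : Set ℝ :=
  {d | 0 ≤ d ∧ ∀ r ∈ Ioc (0 : ℝ) 1,
    ∃ n : ℕ, (n : ℝ) ≤ c * r ^ (-d) ∧ CoverableBy dist (gapShell v r) (r / 8) n}

/-- The zooming dimension with multiplier `c` (meaningful if `zoomingExponents` is nonempty,
i.e. if the zooming dimension with multiplier `c` is finite). -/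
def zoomingDim (dist : X → X → ℝ) (v : X → ℝ) (c : ℝ) : ℝ := sInf (zoomingExponents dist v c)

end Zooming

/-! ### Repeated contracting with stochastic arrivals -/

/-- A (deterministic) learning policy of the principal for `T` rounds: the contract of round `t`
is a function of the outcome levels observed in the rounds before `t`. -/
def Policy (m T : ℕ) : Type := (t : Fin T) → (Fin t.1 → Fin m) → Contract m

/-- The contract posted in round `t` when the sequence of outcome levels is `y`. -/
def Policy.posted {m T : ℕ} (P : Policy m T) (y : Fin T → Fin m) (t : Fin T) : Contract m :=
  P t fun i => y (Fin.castLE t.2.le i)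

section Stochastic

variable {m T : ℕ} {E : ℝ} {Θ : Type*} [MeasurableSpace Θ]

/-- `E_{θ ∼ D}[u_P(s | θ)]`. -/
def expectedUtility (D : Measure Θ) (agent : Θ → AgentType m E) (π : Fin m → ℝ)
    (s : Contract m) : ℝ :=
  ∫ θ, (agent θ).principalUtility π s ∂D

/-- The conditional probability, given that the agent of round `t` has type `θ t` for all `t`, that
the sequence of outcome levels is `y` when the principal uses the policy `P`: in each round the
agent responds to the posted contract, and this action generates the outcome. -/
def outcomeProb (agent : Θ → AgentType m E) (π : Fin m → ℝ) (P : Policy m T)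
    (θ : Fin T → Θ) (y : Fin T → Fin m) : ℝ :=
  ∏ t, (agent (θ t)).prob ((agent (θ t)).response π (P.posted y t)) (y t)

/-- The regret `T * max_s E_θ[u_P(s | θ)] - ∑_t E_θ[u_P(s_t | θ)]` on the outcome sequence `y`. -/
def regret (D : Measure Θ) (agent : Θ → AgentType m E) (π : Fin m → ℝ) (P : Policy m T)
    (y : Fin T → Fin m) : ℝ :=
  T * (⨆ s, expectedUtility D agent π s) - ∑ t, expectedUtility D agent π (P.posted y t)

/-- The expected regret, for types drawn i.i.d. from `D` and outcomes generated by the agents. -/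
def expectedRegret (D : Measure Θ) (agent : Θ → AgentType m E) (π : Fin m → ℝ)
    (P : Policy m T) : ℝ :=
  ∫ θ : Fin T → Θ, ∑ y, outcomeProb agent π P θ y * regret D agent π P y
    ∂(Measure.pi fun _ => D)

end Stochastic

end ContractDesign

end

open ContractDesign

noncomputable section

namespace ContractDesign

/-! ### Strongly concave functions on an interval -/

/-! The problem reduces to a Lipschitz bandit with contracts as arms, which the zooming algorithm
solves.

Lipschitz payoffs. Summation by parts writes the expected payment as `∑ w_k G_k`, where the
increments `w_k ≥ 0` of the contract have sum at most 1. Since `G_0 = 1` is constant, `mu ≥ 0`, so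
the agent's utility is strongly concave with modulus `lam - mu` (`concaveOn_agentUtility`). Hence
the optimal action is unique, and comparing the optimality of two responses shows that it is
Lipschitz in the contract (`response_sub_le`). The principal's utility is then Lipschitz for every
type (`principalUtility_sub_le`), and so is its mean.

Reduction. A policy sees outcomes only, and types are independent across rounds. Integrating out the
types therefore turns the likelihood of an outcome sequence into a product of averaged outcome
probabilities (`expectedRegret_zoomPolicy_eq`): a bandit with rewards `π k - s.pay k` in `[-1, 1]`.

Zooming. After `n` pulls an arm carries a confidence ball of radius `√(B / n)`, `B = 8 log T`. A new
arm is pulled only outside all balls; once they cover everything, the active arm of largest index is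
pulled. As long as all empirical means respect their radii, an arm of gap `g` is pulled at most `10
B / g²` times (`pulls_mul_gap_sq_le`), and arms of gap above `r` keep later new arms at distance
more than `r / 8` (`lt_dist_of_first_pull`). So the shell of gaps in `(r, 2r]` holds at most `c
r^(-z)` pulled arms and costs at most `10 B c r^(-z-1)`. Summing over dyadic `r > δ` and charging `2
δ` per round to the rest gives `sum_gap_le`; the choice `δ = (c log T / T)^(1/(z+2))` balances the
two terms.

Bad event. An exponential supermartingale and a union bound over rounds, first pulls and pull counts
give it probability at most `2 / T` (`sum_zoomProb_not_isClean_le`), hence regret at most 4. This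
constant is absorbed because some contract has gap exactly 1 (`gapShell_half_nonempty`), which keeps
`c` from being too small. -/

theorem concaveOn_sub_sq_of_derivWithin2_le {E M : ℝ} {h : ℝ → ℝ}
    (h1 : DifferentiableOn ℝ h (Icc 0 E))
    (h2 : DifferentiableOn ℝ (derivWithin h (Icc 0 E)) (Icc 0 E))
    (h3 : ∀ a ∈ Icc 0 E, derivWithin (derivWithin h (Icc 0 E)) (Icc 0 E) a ≤ M) :
    ConcaveOn ℝ (Icc 0 E) fun a => h a - M / 2 * a ^ 2 := by
  have hsub : interior (Icc (0 : ℝ) E) ⊆ Icc 0 E := interior_subset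
  refine concaveOn_of_hasDerivWithinAt2_nonpos (convex_Icc 0 E)
    (f' := fun a => derivWithin h (Icc 0 E) a - M * a)
    (f'' := fun a => derivWithin (derivWithin h (Icc 0 E)) (Icc 0 E) a - M)
    ?_ ?_ ?_ ?_
  · exact h1.continuousOn.sub (by fun_prop)
  · intro x hx
    refine (((h1 x (hsub hx)).hasDerivWithinAt).mono hsub).sub ?_
    have := ((hasDerivAt_pow 2 x).const_mul (M / 2)).hasDerivWithinAt (s := interior (Icc 0 E))
    exact this.congr_deriv (by norm_num; ring)
  · intro x hx
    refine (((h2 x (hsub hx)).hasDerivWithinAt).mono hsub).sub ?_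
    simpa using ((hasDerivAt_id x).const_mul M).hasDerivWithinAt (s := interior (Icc 0 E))
  · intro x hx
    exact sub_nonpos.2 (h3 x (hsub hx))

/-- Quadratic growth at a maximizer: strong concavity on the segment from `a` to `b`, evaluated at
parameter `t`, gives the bound with an extra factor `1 - t`, and `t → 0` removes it. No first-order
condition is needed, so boundary maximizers are covered. -/
theorem mul_sq_le_sub_of_isMaxOn {E κ : ℝ} {U : ℝ → ℝ}
    (hU : ConcaveOn ℝ (Icc 0 E) fun a => U a + κ / 2 * a ^ 2) {a b : ℝ} (ha : a ∈ Icc 0 E)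
    (hmax : ∀ x ∈ Icc 0 E, U x ≤ U a) (hb : b ∈ Icc 0 E) :
    κ / 2 * (b - a) ^ 2 ≤ U a - U b := by
  have key : ∀ n : ℕ, (1 - 1 / ((n : ℝ) + 1)) * (κ / 2 * (b - a) ^ 2) ≤ U a - U b := by
    intro n
    set t : ℝ := 1 / ((n : ℝ) + 1) with ht
    have ht0 : 0 < t := by positivity
    have ht1 : t ≤ 1 := by
      rw [ht, div_le_one (by positivity)]
      linarith [(Nat.cast_nonneg n : (0 : ℝ) ≤ n)]
    have h1 := hU.2 ha hb (sub_nonneg.2 ht1) ht0.le (sub_add_cancel 1 t)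
    have h2 := hmax _ (hU.1 ha hb (sub_nonneg.2 ht1) ht0.le (sub_add_cancel 1 t))
    simp only [smul_eq_mul] at h1 h2
    have h3 : t * ((1 - t) * (κ / 2 * (b - a) ^ 2)) ≤ t * (U a - U b) := by
      nlinarith [h1, h2]
    exact le_of_mul_le_mul_left h3 ht0
  have hlim : Filter.Tendsto (fun n : ℕ => (1 - 1 / ((n : ℝ) + 1)) * (κ / 2 * (b - a) ^ 2))
      Filter.atTop (nhds ((1 - 0) * (κ / 2 * (b - a) ^ 2))) :=
    (tendsto_one_div_add_atTop_nhds_zero_nat.const_sub 1).mul_const _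
  have := le_of_tendsto' hlim key
  linarith

/-! ### Summation by parts -/

/-- The increments of a payment vector. -/
def increment {m : ℕ} (p : Fin m → ℝ) (k : Fin m) : ℝ :=
  if h : k.1 = 0 then p k else p k - p ⟨k.1 - 1, by omega⟩

theorem sum_increment_Iic {m : ℕ} (p : Fin m → ℝ) (j : Fin m) :
    ∑ k ∈ Finset.Iic j, increment p k = p j := by
  obtain ⟨j, hj⟩ := j
  induction j with
  | zero =>
    have : Finset.Iic (⟨0, hj⟩ : Fin m) = {⟨0, hj⟩} := by
      ext k; simp [Fin.le_def, Fin.ext_iff]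
    rw [this]; simp [increment]
  | succ j ih =>
    have : Finset.Iic (⟨j + 1, hj⟩ : Fin m)
        = insert ⟨j + 1, hj⟩ (Finset.Iic (⟨j, by omega⟩ : Fin m)) := by
      ext k; simp [Fin.le_def, Fin.ext_iff]; omega
    rw [this, Finset.sum_insert (by simp [Fin.le_def]), ih]
    simp [increment]

theorem increment_nonneg {m : ℕ} {p : Fin m → ℝ} (h0 : ∀ j, 0 ≤ p j) (hp : Monotone p)
    (k : Fin m) : 0 ≤ increment p k := by
  unfold increment
  split_ifs with h
  · exact h0 k
  · exact sub_nonneg.2 (hp (by simp [Fin.le_def]))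

theorem sum_increment_le_one {m : ℕ} {p : Fin m → ℝ} (h1 : ∀ j, p j ≤ 1) :
    ∑ k, increment p k ≤ 1 := by
  rcases Nat.eq_zero_or_pos m with rfl | hm
  · simp
  · have := sum_increment_Iic p ⟨m - 1, by omega⟩
    have hu : Finset.Iic (⟨m - 1, by omega⟩ : Fin m) = Finset.univ := by
      ext k; simp [Fin.le_def]; omega
    rw [hu] at this
    rw [this]; exact h1 _

/-! ### Outcome probabilities and curvature of a regular type -/

namespace AgentType

variable {m : ℕ} {E : ℝ} {θ : AgentType m E} {π : Fin m → ℝ} {lam mu L : ℝ}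

theorem sum_mul_prob_eq (θ : AgentType m E) (p : Fin m → ℝ) (a : ℝ) :
    ∑ j, p j * θ.prob a j = ∑ k, increment p k * θ.ccdf k a := by
  simp_rw [ccdf, Finset.mul_sum]
  rw [Finset.sum_comm' (t' := Finset.univ) (s' := fun j => Finset.Iic j) (by simp)]
  simp_rw [← Finset.sum_mul, sum_increment_Iic]

theorem prob_le_one (θ : AgentType m E) {a : ℝ} (ha : a ∈ Icc 0 E) (j : Fin m) :
    θ.prob a j ≤ 1 := by
  rw [← θ.prob_sum a ha]
  exact Finset.single_le_sum (fun k _ => θ.prob_nonneg a ha k) (Finset.mem_univ j)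

theorem prob_eq_ccdf_sub (θ : AgentType m E) (j : Fin m) (a : ℝ) :
    θ.prob a j = θ.ccdf j a - if h : j.1 + 1 < m then θ.ccdf ⟨j.1 + 1, h⟩ a else 0 := by
  have hd : Finset.Ici j = insert j (Finset.Ioi j) := by
    ext k; rw [Finset.mem_insert, Finset.mem_Ici, Finset.mem_Ioi, le_iff_eq_or_lt, eq_comm]
  rw [ccdf, hd, Finset.sum_insert (by simp)]
  split_ifs with h
  · have : Finset.Ioi j = Finset.Ici (⟨j.1 + 1, h⟩ : Fin m) := by
      ext k; rw [Finset.mem_Ioi, Finset.mem_Ici, Fin.lt_def, Fin.le_def]; exact Nat.lt_iff_add_one_le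
    rw [ccdf, this]; ring
  · have : Finset.Ioi j = ∅ := by
      ext k
      rw [Finset.mem_Ioi, Fin.lt_def]
      simp only [Finset.notMem_empty, iff_false]
      omega
    rw [this]; simp

theorem ccdf_sub_le (h : θ.IsRegular lam mu L) (j : Fin m) {a b : ℝ} (ha : a ∈ Icc 0 E)
    (hb : b ∈ Icc 0 E) : |θ.ccdf j a - θ.ccdf j b| ≤ L * |a - b| :=
  (convex_Icc 0 E).norm_image_sub_le_of_norm_derivWithin_le (h.ccdf_diff j)
    (h.ccdf_lipschitz j) hb ha

theorem lipschitz_nonneg (hE : 0 < E) (h : θ.IsRegular lam mu L) (j : Fin m) : 0 ≤ L :=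
  (abs_nonneg _).trans (h.ccdf_lipschitz j 0 (left_mem_Icc.2 hE.le))

theorem prob_sub_le (hE : 0 < E) (h : θ.IsRegular lam mu L) (j : Fin m) {a b : ℝ}
    (ha : a ∈ Icc 0 E) (hb : b ∈ Icc 0 E) :
    |θ.prob a j - θ.prob b j| ≤ 2 * L * |a - b| := by
  rw [prob_eq_ccdf_sub, prob_eq_ccdf_sub]
  have h1 := ccdf_sub_le h j ha hb
  have hL := lipschitz_nonneg hE h j
  split_ifs with hj
  · have h2 := ccdf_sub_le h ⟨j.1 + 1, hj⟩ ha hb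
    calc _ = |(θ.ccdf j a - θ.ccdf j b)
            - (θ.ccdf ⟨j.1 + 1, hj⟩ a - θ.ccdf ⟨j.1 + 1, hj⟩ b)| := by congr 1; ring
      _ ≤ _ := abs_sub _ _
      _ ≤ 2 * L * |a - b| := by linarith
  · simp only [sub_zero]
    nlinarith [mul_nonneg hL (abs_nonneg (a - b))]

theorem continuousOn_prob (hE : 0 < E) (h : θ.IsRegular lam mu L) (j : Fin m) :
    ContinuousOn (fun a => θ.prob a j) (Icc 0 E) := by
  have hL := lipschitz_nonneg hE h j
  refine LipschitzOnWith.continuousOn (K := ⟨2 * L, by positivity⟩) ?_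
  refine LipschitzOnWith.of_dist_le_mul fun a ha b hb => ?_
  exact prob_sub_le hE h j ha hb

/-- Monotonicity of `p` makes this sum a combination of the `L`-Lipschitz `G_k` with nonnegative
weights of total at most 1, so the constant does not grow with `m`. -/
theorem sum_mul_prob_sub_le (h : θ.IsRegular lam mu L) {p : Fin m → ℝ} (h0 : ∀ j, 0 ≤ p j)
    (hp : Monotone p) (h1 : ∀ j, p j ≤ 1) (hL : 0 ≤ L) {a b : ℝ} (ha : a ∈ Icc 0 E)
    (hb : b ∈ Icc 0 E) :
    |∑ j, p j * θ.prob a j - ∑ j, p j * θ.prob b j| ≤ L * |a - b| := by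
  rw [sum_mul_prob_eq, sum_mul_prob_eq, ← Finset.sum_sub_distrib]
  have hnn : 0 ≤ L * |a - b| := by positivity
  calc _ ≤ ∑ k, |increment p k * θ.ccdf k a - increment p k * θ.ccdf k b| :=
        Finset.abs_sum_le_sum_abs _ _
    _ ≤ ∑ k, increment p k * (L * |a - b|) := by
        refine Finset.sum_le_sum fun k _ => ?_
        rw [← mul_sub, abs_mul, abs_of_nonneg (increment_nonneg h0 hp k)]
        exact mul_le_mul_of_nonneg_left (ccdf_sub_le h k ha hb) (increment_nonneg h0 hp k)
    _ = (∑ k, increment p k) * (L * |a - b|) := by rw [Finset.sum_mul]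
    _ ≤ 1 * (L * |a - b|) := mul_le_mul_of_nonneg_right (sum_increment_le_one h1) hnn
    _ = _ := one_mul _

/-- The tail sum from the lowest level is constantly 1, so its second derivative, which `mu` bounds,
is 0. -/
theorem curvature_nonneg [NeZero m] (hE : 0 < E) (h : θ.IsRegular lam mu L) : 0 ≤ mu := by
  have hz : (0 : ℝ) ∈ Icc 0 E := left_mem_Icc.2 hE.le
  have hc : ∀ a ∈ Icc 0 E, θ.ccdf 0 a = 1 := by
    intro a ha
    have hu : Finset.Ici (0 : Fin m) = Finset.univ := by ext k; simp
    rw [ccdf, hu, θ.prob_sum a ha]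
  have hd : ∀ a ∈ Icc 0 E, derivWithin (θ.ccdf 0) (Icc 0 E) a = 0 := by
    intro a ha
    rw [derivWithin_congr (f := fun _ => (1 : ℝ)) (fun x hx => hc x hx) (hc a ha)]
    simp
  have := h.ccdf_le 0 0 hz
  rw [derivWithin_congr (f := fun _ => (0 : ℝ)) (fun x hx => hd x hx) (hd 0 hz)] at this
  simpa using this

theorem concaveOn_agentUtility [NeZero m] (hE : 0 < E) (h : θ.IsRegular lam mu L)
    (s : Contract m) :
    ConcaveOn ℝ (Icc 0 E) fun a => θ.agentUtility s a + (lam - mu) / 2 * a ^ 2 := by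
  have hmu := curvature_nonneg hE h
  have hw := increment_nonneg s.2.1 s.2.2.1
  have hw1 := sum_increment_le_one s.2.2.2
  have h1 : ConcaveOn ℝ (Icc 0 E)
      fun a => ∑ k, increment s.1 k * (θ.ccdf k a - mu / 2 * a ^ 2) := by
    have : ∀ S : Finset (Fin m), ConcaveOn ℝ (Icc 0 E)
        fun a => ∑ k ∈ S, increment s.1 k * (θ.ccdf k a - mu / 2 * a ^ 2) := by
      intro S
      induction S using Finset.cons_induction with
      | empty => simpa using concaveOn_const (0 : ℝ) (convex_Icc 0 E)
      | cons k S hk ih =>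
        simp_rw [Finset.sum_cons]
        exact ((concaveOn_sub_sq_of_derivWithin2_le (h.ccdf_diff k) (h.ccdf_diff_two k)
          (h.ccdf_le k)).smul (hw k)).add ih
    exact this _
  have h2 : ConcaveOn ℝ (Icc 0 E) fun a => -θ.cost a - (-lam) / 2 * a ^ 2 := by
    have hneg : derivWithin (fun a => -θ.cost a) (Icc 0 E)
        = fun a => -derivWithin θ.cost (Icc 0 E) a := by
      ext a; exact derivWithin.fun_neg
    refine concaveOn_sub_sq_of_derivWithin2_le h.cost_diff.neg ?_ ?_
    · rw [hneg]; exact h.cost_diff_two.neg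
    · intro a ha
      rw [hneg, derivWithin.fun_neg]
      exact neg_le_neg (h.le_cost a ha)
  -- The weights may sum to less than 1; the curvature `mu` that they leave over has the right sign
  -- because `mu ≥ 0`.
  have h3 : ConcaveOn ℝ (Icc 0 E)
      fun a : ℝ => -((mu / 2 * (1 - ∑ k, increment s.1 k)) * a ^ 2) := by
    have : ConvexOn ℝ (Icc 0 E) fun a : ℝ => a ^ 2 :=
      (even_two.convexOn_pow).subset (subset_univ _) (convex_Icc 0 E)
    exact (this.smul (mul_nonneg (by positivity) (sub_nonneg.2 hw1))).neg
  refine ((h1.add h2).add h3).congr fun a _ => ?_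
  simp only [Pi.add_apply, agentUtility, Contract.pay]
  rw [sum_mul_prob_eq]
  simp_rw [mul_sub, Finset.sum_sub_distrib, ← Finset.sum_mul]
  ring

theorem continuousOn_agentUtility (hE : 0 < E) (h : θ.IsRegular lam mu L) (s : Contract m) :
    ContinuousOn (θ.agentUtility s) (Icc 0 E) := by
  unfold agentUtility
  exact (continuousOn_finsetSum _ fun j _ =>
    continuousOn_const.mul (continuousOn_prob hE h j)).sub h.cost_diff.continuousOn

/-! ### The response of a regular agent -/

theorem exists_incentiveCompatible (hE : 0 < E) (h : θ.IsRegular lam mu L) (s : Contract m) :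
    ∃ a, a ∈ θ.incentiveCompatible s := by
  obtain ⟨a, ha, hmax⟩ := isCompact_Icc.exists_isMaxOn (nonempty_Icc.2 hE.le)
    (continuousOn_agentUtility hE h s)
  exact ⟨a, ha, fun b hb => hmax hb⟩

theorem mul_sq_le_of_incentiveCompatible [NeZero m] (hE : 0 < E) (h : θ.IsRegular lam mu L)
    {s : Contract m} {a b : ℝ} (ha : a ∈ θ.incentiveCompatible s) (hb : b ∈ Icc 0 E) :
    (lam - mu) / 2 * (b - a) ^ 2 ≤ θ.agentUtility s a - θ.agentUtility s b :=
  mul_sq_le_sub_of_isMaxOn (concaveOn_agentUtility hE h s) ha.1 ha.2 hb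

theorem incentiveCompatible_unique [NeZero m] (hE : 0 < E) (hlam : mu < lam)
    (h : θ.IsRegular lam mu L) {s : Contract m} {a b : ℝ} (ha : a ∈ θ.incentiveCompatible s)
    (hb : b ∈ θ.incentiveCompatible s) : b = a := by
  have h1 := mul_sq_le_of_incentiveCompatible hE h ha hb.1
  have h2 := hb.2 a ha.1
  have h3 : (lam - mu) / 2 * (b - a) ^ 2 ≤ 0 := by linarith
  have h4 : (b - a) ^ 2 ≤ 0 := by
    by_contra hc
    have : 0 < (lam - mu) / 2 * (b - a) ^ 2 :=
      mul_pos (by linarith) (not_le.1 hc)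
    linarith
  exact sub_eq_zero.1 (pow_eq_zero_iff two_ne_zero |>.1 (le_antisymm h4 (sq_nonneg _)))

theorem response_mem [NeZero m] (hE : 0 < E) (hlam : mu < lam) (h : θ.IsRegular lam mu L)
    (π : Fin m → ℝ) (s : Contract m) : θ.response π s ∈ θ.incentiveCompatible s := by
  obtain ⟨a, ha⟩ := exists_incentiveCompatible hE h s
  have hex : ∃ a ∈ θ.incentiveCompatible s,
      ∀ b ∈ θ.incentiveCompatible s, θ.principalUtilityAt π s b ≤ θ.principalUtilityAt π s a :=
    ⟨a, ha, fun b hb => by rw [incentiveCompatible_unique hE hlam h ha hb]⟩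
  rw [response, dif_pos hex]
  exact hex.choose_spec.1

theorem principalUtility_eq [NeZero m] (hE : 0 < E) (hlam : mu < lam) (h : θ.IsRegular lam mu L)
    (π : Fin m → ℝ) (s : Contract m) :
    θ.principalUtility π s = ∑ j, (π j - s.pay j) * θ.prob (θ.response π s) j := by
  have hr := response_mem hE hlam h π s
  have : θ.incentiveCompatible s = {θ.response π s} :=
    eq_singleton_iff_unique_mem.2 ⟨hr, fun b hb => incentiveCompatible_unique hE hlam h hr hb⟩
  rw [principalUtility, this, image_singleton, csSup_singleton, principalUtilityAt]

/-- Adding the quadratic growth bounds at the two optima cancels the costs and leaves `(lam - mu) |a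
- b|² ≤ ∑ (s_j - s'_j) (f_j(a) - f_j(b))`. Each `f_j` is `2L`-Lipschitz, and one factor `|a - b|`
cancels. -/
theorem response_sub_le [NeZero m] (hE : 0 < E) (hlam : mu < lam) (h : θ.IsRegular lam mu L)
    (π : Fin m → ℝ) (s s' : Contract m) :
    |θ.response π s - θ.response π s'|
      ≤ 2 * L / (lam - mu) * ∑ j, |s.pay j - s'.pay j| := by
  set a := θ.response π s
  set b := θ.response π s'
  set δ := ∑ j, |s.pay j - s'.pay j| with hδ
  have ha : a ∈ θ.incentiveCompatible s := response_mem hE hlam h π s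
  have hb : b ∈ θ.incentiveCompatible s' := response_mem hE hlam h π s'
  have h1 := mul_sq_le_of_incentiveCompatible hE h ha hb.1
  have h2 := mul_sq_le_of_incentiveCompatible hE h hb ha.1
  have hκ : 0 < lam - mu := sub_pos.2 hlam
  have hL := lipschitz_nonneg hE h 0
  have h3 : (θ.agentUtility s a - θ.agentUtility s b)
      + (θ.agentUtility s' b - θ.agentUtility s' a)
      = ∑ j, (s.pay j - s'.pay j) * (θ.prob a j - θ.prob b j) := by
    simp only [agentUtility, sub_mul, mul_sub, Finset.sum_sub_distrib]; ring
  have h4 : ∑ j, (s.pay j - s'.pay j) * (θ.prob a j - θ.prob b j) ≤ δ * (2 * L * |a - b|) := by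
    rw [hδ, Finset.sum_mul]
    refine Finset.sum_le_sum fun j _ => (le_abs_self _).trans ?_
    rw [abs_mul]
    exact mul_le_mul_of_nonneg_left (prob_sub_le hE h j ha.1 hb.1) (abs_nonneg _)
  have h5 : (lam - mu) * |a - b| ^ 2 ≤ δ * (2 * L * |a - b|) := by
    rw [sq_abs]; nlinarith
  have hδ0 : 0 ≤ δ := Finset.sum_nonneg fun j _ => abs_nonneg _
  rw [div_mul_eq_mul_div, le_div_iff₀ hκ]
  rcases (abs_nonneg (a - b)).eq_or_lt with h0 | h0
  · rw [← h0, zero_mul]; positivity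
  · refine le_of_mul_le_mul_right ?_ h0
    nlinarith

theorem principalUtility_sub_le [NeZero m] (hE : 0 < E) (hlam : mu < lam)
    (h : θ.IsRegular lam mu L) {π : Fin m → ℝ} (hπ0 : ∀ j, 0 ≤ π j) (hπ : Monotone π)
    (hπ1 : ∀ j, π j ≤ 1) (s s' : Contract m) :
    |θ.principalUtility π s - θ.principalUtility π s'| ≤ contractDist (lipConst lam mu L) s s' := by
  rw [principalUtility_eq hE hlam h, principalUtility_eq hE hlam h]
  have hr := response_sub_le hE hlam h π s s'
  have ha := (response_mem hE hlam h π s).1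
  have hb := (response_mem hE hlam h π s').1
  set a := θ.response π s
  set b := θ.response π s'
  have hL := lipschitz_nonneg hE h 0
  have h1 := sum_mul_prob_sub_le h hπ0 hπ hπ1 hL ha hb
  have h2 := sum_mul_prob_sub_le h s'.2.1 s'.2.2.1 s'.2.2.2 hL ha hb
  have h3 : |∑ j, (s.pay j - s'.pay j) * θ.prob a j| ≤ ∑ j, |s.pay j - s'.pay j| := by
    refine (Finset.abs_sum_le_sum_abs _ _).trans (Finset.sum_le_sum fun j _ => ?_)
    rw [abs_mul, abs_of_nonneg (θ.prob_nonneg a ha j)]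
    exact mul_le_of_le_one_right (abs_nonneg _) (θ.prob_le_one ha j)
  have hδ0 : 0 ≤ ∑ j, |s.pay j - s'.pay j| := Finset.sum_nonneg fun j _ => abs_nonneg _
  have h4 : 2 * L * |a - b| ≤ 4 * L ^ 2 / (lam - mu) * ∑ j, |s.pay j - s'.pay j| := by
    calc _ ≤ 2 * L * (2 * L / (lam - mu) * ∑ j, |s.pay j - s'.pay j|) := by gcongr
      _ = _ := by ring
  -- The change of action costs at most `L |a - b|` in value and as much in payments under `s'`; the
  -- change of contract at fixed action costs at most `‖s - s'‖₁`.
  have h5 : ∑ j, (π j - s.pay j) * θ.prob a j - ∑ j, (π j - s'.pay j) * θ.prob b j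
      = (∑ j, π j * θ.prob a j - ∑ j, π j * θ.prob b j)
        - (∑ j, s'.1 j * θ.prob a j - ∑ j, s'.1 j * θ.prob b j)
        - ∑ j, (s.pay j - s'.pay j) * θ.prob a j := by
    simp only [Contract.pay, sub_mul, Finset.sum_sub_distrib]; ring
  rw [h5, contractDist, lipConst]
  rw [abs_le] at *
  constructor <;> nlinarith

/-! ### Measurability of the response -/

/-- The maximal utility is a supremum over a countable dense set of actions, hence measurable in the
type. So is the choice of the first dense action within `1 / (n + 1)` of it. By quadratic growth
these near-maximizers converge to the response, and the outcome probabilities are continuous. -/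
theorem measurable_prob_response [NeZero m] (hE : 0 < E) (hlam : mu < lam) {Θ : Type*}
    [MeasurableSpace Θ] {agent : Θ → AgentType m E}
    (hc : ∀ a ∈ Icc 0 E, Measurable fun θ => (agent θ).cost a)
    (hp : ∀ a ∈ Icc 0 E, ∀ j, Measurable fun θ => (agent θ).prob a j)
    (h : ∀ θ, (agent θ).IsRegular lam mu L) (π : Fin m → ℝ) (s : Contract m) (j : Fin m) :
    Measurable fun θ => (agent θ).prob ((agent θ).response π s) j := by
  classical
  have : Nonempty (Icc (0 : ℝ) E) := ⟨⟨0, left_mem_Icc.2 hE.le⟩⟩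
  let d : ℕ → Icc (0 : ℝ) E := TopologicalSpace.denseSeq _
  have hU : ∀ i, Measurable fun θ => (agent θ).agentUtility s (d i) := by
    intro i
    unfold agentUtility
    exact (Finset.measurable_sum _ fun k _ => (hp _ (d i).2 k).const_mul _).sub (hc _ (d i).2)
  have hmem := fun θ => response_mem hE hlam (h θ) π s
  have hdense : ∀ θ, ∀ ε > 0, ∃ i, (agent θ).agentUtility s ((agent θ).response π s) - ε
      < (agent θ).agentUtility s (d i) := by
    intro θ ε hε
    have hcont : Continuous fun x : Icc (0 : ℝ) E => (agent θ).agentUtility s x :=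
      (continuousOn_iff_continuous_domRestrict.1 (continuousOn_agentUtility hE (h θ) s))
    have hopen : IsOpen {x : Icc (0 : ℝ) E |
        (agent θ).agentUtility s ((agent θ).response π s) - ε < (agent θ).agentUtility s x} :=
      isOpen_lt continuous_const hcont
    obtain ⟨i, hi⟩ := (TopologicalSpace.denseRange_denseSeq (Icc (0 : ℝ) E)).exists_mem_open
      hopen ⟨⟨_, (hmem θ).1⟩, by simpa using hε⟩
    exact ⟨i, hi⟩
  have hsup : ∀ θ, ⨆ i, (agent θ).agentUtility s (d i)
      = (agent θ).agentUtility s ((agent θ).response π s) := by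
    intro θ
    refine ciSup_eq_of_forall_le_of_forall_lt_exists_gt (fun i => (hmem θ).2 _ (d i).2) ?_
    intro w hw
    obtain ⟨i, hi⟩ := hdense θ _ (sub_pos.2 hw)
    exact ⟨i, by linarith⟩
  have hsupm : Measurable fun θ => (agent θ).agentUtility s ((agent θ).response π s) := by
    simp_rw [← hsup]; exact Measurable.iSup hU
  have hex : ∀ n : ℕ, ∀ θ, ∃ i, (agent θ).agentUtility s ((agent θ).response π s)
      - 1 / ((n : ℝ) + 1) < (agent θ).agentUtility s (d i) :=
    fun n θ => hdense θ _ (by positivity)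
  refine measurable_of_tendsto_metrizable
    (f := fun (n : ℕ) θ => (agent θ).prob (d (Nat.find (hex n θ))) j) (fun n => ?_) ?_
  · exact Measurable.find (f := fun i θ => (agent θ).prob (d i) j)
      (p := fun i θ => (agent θ).agentUtility s ((agent θ).response π s)
        - 1 / ((n : ℝ) + 1) < (agent θ).agentUtility s (d i)) (fun i => hp _ (d i).2 j)
      (fun i => measurableSet_lt (hsupm.sub_const _) (hU i)) (hex n)
  · rw [tendsto_pi_nhds]
    intro θ
    have hκ : 0 < (lam - mu) / 2 := by linarith
    have hsq : Filter.Tendsto (fun n : ℕ => ((d (Nat.find (hex n θ)) : ℝ)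
        - (agent θ).response π s) ^ 2) Filter.atTop (nhds 0) := by
      have hb : Filter.Tendsto (fun n : ℕ => (1 / ((n : ℝ) + 1)) / ((lam - mu) / 2))
          Filter.atTop (nhds (0 / ((lam - mu) / 2))) :=
        tendsto_one_div_add_atTop_nhds_zero_nat.div_const _
      rw [zero_div] at hb
      refine squeeze_zero (fun n => sq_nonneg _) (fun n => ?_) hb
      rw [le_div_iff₀ hκ, mul_comm]
      have h1 := mul_sq_le_of_incentiveCompatible hE (h θ) (hmem θ) (d (Nat.find (hex n θ))).2
      have h2 := Nat.find_spec (hex n θ)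
      linarith
    have habs : Filter.Tendsto (fun n : ℕ => (d (Nat.find (hex n θ)) : ℝ)
        - (agent θ).response π s) Filter.atTop (nhds 0) := by
      rw [tendsto_zero_iff_abs_tendsto_zero]
      have := hsq.sqrt
      simpa [Real.sqrt_sq_eq_abs, Function.comp_def] using this
    have hlim : Filter.Tendsto (fun n : ℕ => (d (Nat.find (hex n θ)) : ℝ)) Filter.atTop
        (nhds ((agent θ).response π s)) := by
      have := habs.add_const ((agent θ).response π s)
      simpa using this
    exact (continuousOn_prob hE (h θ) j _ (hmem θ).1).tendsto.comp
      (tendsto_nhdsWithin_iff.2 ⟨hlim, Filter.Eventually.of_forall fun n => (d _).2⟩)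

end AgentType

/-! ### The zooming algorithm -/

section ZoomingAlgorithm

variable {X Y : Type*}

open Classical in
/-- The rounds before `t` in which the arm `a` is pulled. -/
def pullTimes (x : ℕ → X) (t : ℕ) (a : X) : Finset ℕ := (Finset.range t).filter fun i => x i = a

/-- The number of pulls of the arm `a` before round `t`. -/
def pulls (x : ℕ → X) (t : ℕ) (a : X) : ℕ := (pullTimes x t a).card

/-- The total reward of the arm `a` before round `t`. -/
def gain (x : ℕ → X) (R : ℕ → ℝ) (t : ℕ) (a : X) : ℝ := ∑ i ∈ pullTimes x t a, R i

/-- The confidence radius after `n` pulls. -/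
def radius (B : ℝ) (n : ℕ) : ℝ := √(B / n)

/-- The optimistic index of the arm `a` in round `t`. -/
def zoomIndex (B : ℝ) (x : ℕ → X) (R : ℕ → ℝ) (t : ℕ) (a : X) : ℝ :=
  gain x R t a / pulls x t a + 2 * radius B (pulls x t a)

/-- Arm `a` is a legitimate choice of the zooming algorithm in round `t`: it is not covered by the
confidence balls of the arms pulled so far or, if these balls cover everything, it is among the
arms pulled so far and maximizes the index. -/
def IsZoomStep (D : X → X → ℝ) (B : ℝ) (t : ℕ) (x : ℕ → X) (R : ℕ → ℝ) (a : X) : Prop :=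
  (∀ i < t, radius B (pulls x t (x i)) < D (x i) a) ∨
    ((∀ b, ∃ i < t, D (x i) b ≤ radius B (pulls x t (x i))) ∧
      ∃ i < t, a = x i ∧ ∀ j < t, zoomIndex B x R t (x j) ≤ zoomIndex B x R t (x i))

theorem pullTimes_congr {x x' : ℕ → X} {t : ℕ} (hx : ∀ i < t, x i = x' i) (a : X) :
    pullTimes x t a = pullTimes x' t a := by
  classical
  exact Finset.filter_congr fun i hi => by rw [hx i (Finset.mem_range.1 hi)]

theorem mem_pullTimes {x : ℕ → X} {t : ℕ} {a : X} {i : ℕ} :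
    i ∈ pullTimes x t a ↔ i < t ∧ x i = a := by
  simp [pullTimes]

theorem gain_congr {x x' : ℕ → X} {R R' : ℕ → ℝ} {t : ℕ} (hx : ∀ i < t, x i = x' i)
    (hR : ∀ i < t, R i = R' i) (a : X) : gain x R t a = gain x' R' t a := by
  rw [gain, gain, pullTimes_congr hx]
  exact Finset.sum_congr rfl fun i hi => hR i (mem_pullTimes.1 hi).1

theorem IsZoomStep.congr {D : X → X → ℝ} {B : ℝ} {t : ℕ} {x x' : ℕ → X} {R R' : ℕ → ℝ} {a : X}
    (h : IsZoomStep D B t x R a) (hx : ∀ i < t, x i = x' i) (hR : ∀ i < t, R i = R' i) :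
    IsZoomStep D B t x' R' a := by
  have hp : pulls x t = pulls x' t := funext fun a => by rw [pulls, pulls, pullTimes_congr hx]
  have hi : zoomIndex B x R t = zoomIndex B x' R' t :=
    funext fun a => by rw [zoomIndex, zoomIndex, gain_congr hx hR, hp]
  refine h.imp (fun h i hi => ?_) (fun h => ⟨fun b => ?_, ?_⟩)
  · rw [← hx i hi, ← hp]; exact h i hi
  · obtain ⟨i, hi, h⟩ := h.1 b
    exact ⟨i, hi, by rw [← hx i hi, ← hp]; exact h⟩
  · obtain ⟨i, hit, ha, h⟩ := h.2
    refine ⟨i, hit, by rw [← hx i hit]; exact ha, fun j hj => ?_⟩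
    rw [← hi, ← hx i hit, ← hx j hj]; exact h j hj

theorem exists_isZoomStep [Nonempty X] (D : X → X → ℝ) (B : ℝ) (t : ℕ) (x : ℕ → X) (R : ℕ → ℝ) :
    ∃ a, IsZoomStep D B t x R a := by
  by_cases h : ∃ a, ∀ i < t, radius B (pulls x t (x i)) < D (x i) a
  · exact h.imp fun a ha => Or.inl ha
  · push Not at h
    obtain ⟨i₀, hi₀, -⟩ := h (Classical.arbitrary X)
    obtain ⟨i, hi, hmax⟩ := (Finset.range t).exists_max_image
      (fun i => zoomIndex B x R t (x i)) ⟨i₀, Finset.mem_range.2 hi₀⟩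
    exact ⟨x i, Or.inr ⟨h, i, Finset.mem_range.1 hi, rfl,
      fun j hj => hmax j (Finset.mem_range.2 hj)⟩⟩

open Classical in
/-- The arm pulled by the zooming algorithm in round `t` if the sequence of observations is `y` and
the arm `a` with observation `k` has reward `rew a k`. -/
def zoomArm [Nonempty X] (D : X → X → ℝ) (B : ℝ) (rew : X → Y → ℝ) (y : ℕ → Y) (t : ℕ) : X :=
  Classical.epsilon (IsZoomStep D B t
    (fun i => if _h : i < t then zoomArm D B rew y i else Classical.arbitrary X)
    (fun i => if _h : i < t then rew (zoomArm D B rew y i) (y i) else 0))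
termination_by t

theorem zoomArm_congr [Nonempty X] (D : X → X → ℝ) (B : ℝ) (rew : X → Y → ℝ) {y y' : ℕ → Y}
    (t : ℕ) (h : ∀ i < t, y i = y' i) : zoomArm D B rew y t = zoomArm D B rew y' t := by
  induction t using Nat.strong_induction_on with
  | _ t ih =>
    have hx : ∀ i < t, zoomArm D B rew y i = zoomArm D B rew y' i :=
      fun i hi => ih i hi fun j hj => h j (hj.trans hi)
    rw [zoomArm, zoomArm]
    congr 2
    · funext i; split_ifs with hi
      · exact hx i hi
      · rfl
    · funext i; split_ifs with hi
      · rw [hx i hi, h i hi]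
      · rfl

theorem isZoomStep_zoomArm [Nonempty X] (D : X → X → ℝ) (B : ℝ) (rew : X → Y → ℝ) (y : ℕ → Y)
    (t : ℕ) : IsZoomStep D B t (zoomArm D B rew y) (fun i => rew (zoomArm D B rew y i) (y i))
      (zoomArm D B rew y t) := by
  have h := Classical.epsilon_spec (exists_isZoomStep D B t
    (fun i => if _h : i < t then zoomArm D B rew y i else Classical.arbitrary X)
    (fun i => if _h : i < t then rew (zoomArm D B rew y i) (y i) else 0))
  rw [← zoomArm] at h
  exact h.congr (fun i hi => dif_pos hi) (fun i hi => dif_pos hi)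

/-! ### Regret of the zooming algorithm if the confidence bounds hold -/

theorem pulls_succ_of_eq {x : ℕ → X} {t : ℕ} {a : X} (h : x t = a) :
    pulls x (t + 1) a = pulls x t a + 1 := by
  have : pullTimes x (t + 1) a = insert t (pullTimes x t a) := by
    ext i
    rw [Finset.mem_insert, mem_pullTimes, mem_pullTimes]
    constructor
    · rintro ⟨h1, h2⟩
      rcases Nat.lt_succ_iff_lt_or_eq.1 h1 with h3 | h3
      · exact Or.inr ⟨h3, h2⟩
      · exact Or.inl h3
    · rintro (rfl | ⟨h1, h2⟩)
      · exact ⟨Nat.lt_succ_self _, h⟩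
      · exact ⟨by omega, h2⟩
  rw [pulls, this, Finset.card_insert_of_notMem (by simp [mem_pullTimes]), pulls]

theorem pulls_succ_of_ne {x : ℕ → X} {t : ℕ} {a : X} (h : x t ≠ a) :
    pulls x (t + 1) a = pulls x t a := by
  have : pullTimes x (t + 1) a = pullTimes x t a := by
    ext i
    rw [mem_pullTimes, mem_pullTimes]
    constructor
    · rintro ⟨h1, h2⟩
      rcases Nat.lt_succ_iff_lt_or_eq.1 h1 with h3 | h3
      · exact ⟨h3, h2⟩
      · exact absurd (h3 ▸ h2) h
    · rintro ⟨h1, h2⟩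
      exact ⟨by omega, h2⟩
  rw [pulls, this, pulls]

theorem pulls_pos {x : ℕ → X} {t i : ℕ} (hi : i < t) : 0 < pulls x t (x i) :=
  Finset.card_pos.2 ⟨i, mem_pullTimes.2 ⟨hi, rfl⟩⟩

theorem radius_nonneg (B : ℝ) (n : ℕ) : 0 ≤ radius B n := Real.sqrt_nonneg _

theorem mul_radius {B : ℝ} (hB : 0 ≤ B) (n : ℕ) : n * radius B n = √(B * n) := by
  rcases Nat.eq_zero_or_pos n with rfl | hn
  · simp
  · have hn' : (0 : ℝ) < n := by exact_mod_cast hn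
    rw [radius, eq_comm, Real.sqrt_eq_iff_mul_self_eq (by positivity) (by positivity),
      mul_mul_mul_comm, Real.mul_self_sqrt (by positivity)]
    field_simp

/-- All the empirical means before round `T` are accurate up to their confidence radii. -/
def IsClean (B : ℝ) (v : X → ℝ) (x : ℕ → X) (R : ℕ → ℝ) (T : ℕ) : Prop :=
  ∀ t < T, ∀ i < t, |gain x R t (x i) - pulls x t (x i) * v (x i)| ≤
    √(B * pulls x t (x i))

variable {D : X → X → ℝ} {B : ℝ} {v : X → ℝ} {x : ℕ → X} {R : ℕ → ℝ} {T : ℕ}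

theorem IsClean.abs_mean_sub_le (h : IsClean B v x R T) (hB : 0 ≤ B) {t i : ℕ} (ht : t < T)
    (hi : i < t) : |gain x R t (x i) / pulls x t (x i) - v (x i)| ≤
      radius B (pulls x t (x i)) := by
  have hn : (0 : ℝ) < pulls x t (x i) := by exact Nat.cast_pos.2 (pulls_pos hi)
  have h1 := h t ht i hi
  rw [← mul_radius hB] at h1
  refine le_of_mul_le_mul_left ?_ hn
  calc _ = |(pulls x t (x i) : ℝ) * (gain x R t (x i) / pulls x t (x i) - v (x i))| := by
        rw [abs_mul, abs_of_pos hn]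
    _ = |gain x R t (x i) - pulls x t (x i) * v (x i)| := by
        congr 1; field_simp
    _ ≤ _ := h1

theorem gap_nonneg (hv : BddAbove (range v)) (a : X) : 0 ≤ gap v a :=
  sub_nonneg.2 (le_ciSup hv a)

/-- Optimism: a nearly optimal arm `b` lies in the ball of some active arm `x j`, whose index
exceeds its empirical mean by one radius for estimation and one for the distance to `b`. So the
index of `x j` is at least `v b`. The index of `x i` is no smaller, and is at most `v (x i)` plus
three radii. -/
theorem gap_le_of_covered [Nonempty X] (hLip : ∀ a b, |v a - v b| ≤ D a b)
    (hB : 0 ≤ B) (hclean : IsClean B v x R T) {t i : ℕ} (ht : t < T)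
    (hcov : ∀ b, ∃ i < t, D (x i) b ≤ radius B (pulls x t (x i))) (hi : i < t)
    (hmax : ∀ j < t, zoomIndex B x R t (x j) ≤ zoomIndex B x R t (x i)) :
    gap v (x i) ≤ 3 * radius B (pulls x t (x i)) := by
  refine le_of_forall_pos_le_add fun ε hε => ?_
  obtain ⟨b, hb⟩ := exists_lt_of_lt_ciSup (sub_lt_self (⨆ a, v a) hε)
  obtain ⟨j, hj, hjb⟩ := hcov b
  have h1 := abs_le.1 (hclean.abs_mean_sub_le hB ht hi)
  have h2 := abs_le.1 (hclean.abs_mean_sub_le hB ht hj)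
  have h3 := abs_le.1 (hLip (x j) b)
  have h4 := hmax j hj
  unfold zoomIndex at h4
  unfold gap
  linarith [h1.2, h2.1, h3.1]

/-- Just before a repeated pull the gap is at most three radii, so `n * gap² ≤ 9 B`; the pull itself
adds at most `4 ≤ B`. -/
theorem pulls_mul_gap_sq_le [Nonempty X] (hv : BddAbove (range v))
    (hD : ∀ a, D a a = 0) (hLip : ∀ a b, |v a - v b| ≤ D a b) (hgap : ∀ a, gap v a ≤ 2)
    (hB : 4 ≤ B) (hstep : ∀ t < T, IsZoomStep D B t x R (x t)) (hclean : IsClean B v x R T)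
    (a : X) {t : ℕ} (ht : t ≤ T) : pulls x t a * gap v a ^ 2 ≤ 10 * B := by
  have hB0 : 0 ≤ B := by linarith
  have hg4 : gap v a ^ 2 ≤ 4 := by nlinarith [hgap a, gap_nonneg hv a]
  induction t with
  | zero => simp [pulls, pullTimes, hB0]
  | succ t ih =>
    by_cases hxt : x t = a
    · rw [pulls_succ_of_eq hxt]
      push_cast
      rcases hstep t ht with h | ⟨hcov, i, hi, hxi, hmax⟩
      · have h0 : pulls x t a = 0 := by
          rw [pulls, Finset.card_eq_zero, Finset.eq_empty_iff_forall_notMem]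
          intro i hi
          rw [mem_pullTimes] at hi
          have := h i hi.1
          rw [hi.2, hxt, hD] at this
          exact absurd this (not_lt.2 (radius_nonneg _ _))
        rw [h0]; push_cast; linarith
      · have h1 := gap_le_of_covered hLip hB0 hclean ht hcov hi hmax
        have hn : (0 : ℝ) < pulls x t (x i) := by exact Nat.cast_pos.2 (pulls_pos hi)
        rw [← hxi, hxt] at h1 hn
        have h2 : gap v a ^ 2 ≤ 9 * (B / pulls x t a) := by
          calc gap v a ^ 2 ≤ (3 * radius B (pulls x t a)) ^ 2 :=
                pow_le_pow_left₀ (gap_nonneg hv a) h1 2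
            _ = 9 * (B / pulls x t a) := by
                rw [mul_pow, radius, Real.sq_sqrt (by positivity)]; norm_num
        have h3 : pulls x t a * gap v a ^ 2 ≤ 9 * B := by
          calc _ ≤ pulls x t a * (9 * (B / pulls x t a)) := by gcongr
            _ = 9 * B := by field_simp
        linarith
    · rw [pulls_succ_of_ne hxt]
      exact ih (by omega)

/-- A new arm lies outside the ball of `x i`, and the bound on pulls keeps that radius at least `r /
√10`, which exceeds `r / 8`. -/
theorem lt_dist_of_first_pull [Nonempty X] (hv : BddAbove (range v))
    (hD : ∀ a, D a a = 0) (hLip : ∀ a b, |v a - v b| ≤ D a b) (hgap : ∀ a, gap v a ≤ 2)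
    (hB : 4 ≤ B) (hstep : ∀ t < T, IsZoomStep D B t x R (x t)) (hclean : IsClean B v x R T)
    {r : ℝ} (hr : 0 < r) {i j : ℕ} (hij : i < j) (hj : j < T) (hfirst : ∀ k < j, x k ≠ x j)
    (hi : r < gap v (x i)) : r / 8 < D (x i) (x j) := by
  rcases hstep j hj with h | ⟨-, k, hk, hxk, -⟩
  · refine lt_of_le_of_lt ?_ (h i hij)
    have hn : (0 : ℝ) < pulls x j (x i) := by exact Nat.cast_pos.2 (pulls_pos hij)
    have h1 := pulls_mul_gap_sq_le hv hD hLip hgap hB hstep hclean (x i) hj.le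
    refine Real.le_sqrt_of_sq_le ?_
    rw [le_div_iff₀ hn]
    have h2 : r ^ 2 ≤ gap v (x i) ^ 2 := pow_le_pow_left₀ hr.le hi.le 2
    have h3 := mul_le_mul_of_nonneg_left h2 hn.le
    nlinarith
  · exact absurd hxk.symm (hfirst k hk)

theorem exists_first_pull {j : ℕ} : ∃ i ≤ j, x i = x j ∧ ∀ k < i, x k ≠ x i := by
  classical
  have h : ∃ i, x i = x j := ⟨j, rfl⟩
  refine ⟨Nat.find h, Nat.find_min' h rfl, Nat.find_spec h, fun k hk => ?_⟩
  rw [Nat.find_spec h]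
  exact Nat.find_min h hk

open Classical in
-- Two distinct pulled arms of the shell cannot share a covering set: ordered by first pull, they
-- are more than `r / 8` apart.
theorem card_shell_le [Nonempty X] (hv : BddAbove (range v))
    (hD : ∀ a, D a a = 0) (hLip : ∀ a b, |v a - v b| ≤ D a b) (hgap : ∀ a, gap v a ≤ 2)
    (hB : 4 ≤ B) (hstep : ∀ t < T, IsZoomStep D B t x R (x t)) (hclean : IsClean B v x R T)
    {r : ℝ} (hr : 0 < r) {n : ℕ} (hcov : CoverableBy D (gapShell v r) (r / 8) n) :
    (((Finset.range T).filter fun t => x t ∈ gapShell v r).image x).card ≤ n := by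
  obtain ⟨U, hU, hdiam⟩ := hcov
  rcases Nat.eq_zero_or_pos n with rfl | hn
  · rw [Nat.le_zero, Finset.card_eq_zero, Finset.image_eq_empty,
      Finset.filter_eq_empty_iff]
    intro t _ ht
    obtain ⟨i, -⟩ := mem_iUnion.1 (hU ht)
    exact i.elim0
  · have hsel : ∀ a, ∃ k : Fin n, a ∈ gapShell v r → a ∈ U k := fun a => by
      by_cases ha : a ∈ gapShell v r
      · obtain ⟨i, hi⟩ := mem_iUnion.1 (hU ha)
        exact ⟨i, fun _ => hi⟩
      · exact ⟨⟨0, hn⟩, fun h => absurd h ha⟩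
    choose f hf using hsel
    conv_rhs => rw [← Fintype.card_fin n, ← Finset.card_univ]
    refine Finset.card_le_card_of_injOn f (fun _ _ => Finset.mem_coe.2 (Finset.mem_univ _)) ?_
    have key : ∀ i j, i < j → j < T → (∀ k < j, x k ≠ x j) → x i ∈ gapShell v r →
        x j ∈ gapShell v r → f (x i) = f (x j) → False := by
      intro i j hij hj hfirst hi hj' hfij
      have h1 := lt_dist_of_first_pull hv hD hLip hgap hB hstep hclean hr hij hj hfirst hi.1
      have h2 := hdiam _ _ (hf _ hi) _ (hfij ▸ hf _ hj')
      linarith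
    intro a ha b hb hab
    simp only [Finset.coe_image, Finset.coe_filter, Finset.mem_range, mem_image,
      mem_ofPred_eq] at ha hb
    obtain ⟨i', ⟨hi', hai⟩, rfl⟩ := ha
    obtain ⟨j', ⟨hj', hbj⟩, rfl⟩ := hb
    obtain ⟨i, hii, hxi, hif⟩ := exists_first_pull (x := x) (j := i')
    obtain ⟨j, hjj, hxj, hjf⟩ := exists_first_pull (x := x) (j := j')
    rw [← hxi] at hai hab ⊢
    rw [← hxj] at hbj hab ⊢
    rcases lt_trichotomy i j with h | h | h
    · exact (key i j h (by omega) hjf hai hbj hab).elim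
    · rw [h]
    · exact (key j i h (by omega) hif hbj hai hab.symm).elim

open Classical in
theorem sum_gap_shell_le [Nonempty X] (hv : BddAbove (range v))
    (hD : ∀ a, D a a = 0) (hLip : ∀ a b, |v a - v b| ≤ D a b) (hgap : ∀ a, gap v a ≤ 2)
    (hB : 4 ≤ B) (hstep : ∀ t < T, IsZoomStep D B t x R (x t)) (hclean : IsClean B v x R T)
    {r : ℝ} (hr : 0 < r) {n : ℕ} (hcov : CoverableBy D (gapShell v r) (r / 8) n) :
    ∑ t ∈ (Finset.range T).filter (fun t => x t ∈ gapShell v r), gap v (x t)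
      ≤ n * (10 * B / r) := by
  set F := (Finset.range T).filter fun t => x t ∈ gapShell v r with hF
  rw [Finset.sum_comp (gap v) x]
  have hB0 : 0 ≤ 10 * B / r := div_nonneg (by linarith) hr.le
  calc _ ≤ ∑ a ∈ F.image x, 10 * B / r := by
        refine Finset.sum_le_sum fun a ha => ?_
        obtain ⟨t, ht, rfl⟩ := Finset.mem_image.1 ha
        have hsh : r < gap v (x t) := (Finset.mem_filter.1 ht).2.1
        have h1 := pulls_mul_gap_sq_le hv hD hLip hgap hB hstep hclean (x t) le_rfl
        have h2 : (F.filter fun i => x i = x t).card ≤ pulls x T (x t) := by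
          refine Finset.card_le_card fun i hi => ?_
          rw [Finset.mem_filter, hF, Finset.mem_filter, Finset.mem_range] at hi
          exact mem_pullTimes.2 ⟨hi.1.1, hi.2⟩
        have h3 : ((F.filter fun i => x i = x t).card : ℝ) ≤ pulls x T (x t) := by
          exact_mod_cast h2
        rw [nsmul_eq_mul, le_div_iff₀ hr]
        have hg : 0 < gap v (x t) := hr.trans hsh
        calc _ ≤ (pulls x T (x t) : ℝ) * gap v (x t) * gap v (x t) := by gcongr
          _ = (pulls x T (x t) : ℝ) * gap v (x t) ^ 2 := by ring
          _ ≤ _ := h1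
    _ = ((F.image x).card : ℝ) * (10 * B / r) := by rw [Finset.sum_const, nsmul_eq_mul]
    _ ≤ n * (10 * B / r) := by
        gcongr
        exact card_shell_le hv hD hLip hgap hB hstep hclean hr hcov

/-! ### Summation over dyadic shells and attainment of the zooming dimension -/

theorem sum_pow_filter_le {b W : ℝ} (hb : 2 ≤ b) (hW : 0 ≤ W) (M : ℕ) :
    ∑ i ∈ (Finset.range M).filter (fun i => b ^ i ≤ W), b ^ i ≤ 2 * W := by
  have hgeo : ∀ N : ℕ, ∑ i ∈ Finset.range N, b ^ i ≤ b ^ N := by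
    intro N
    induction N with
    | zero => simp
    | succ N ih =>
      rw [Finset.sum_range_succ, pow_succ]
      nlinarith [pow_pos (by linarith : (0 : ℝ) < b) N]
  induction M with
  | zero => simpa using hW
  | succ M ih =>
    by_cases h : b ^ M ≤ W
    · calc _ ≤ ∑ i ∈ Finset.range (M + 1), b ^ i :=
            Finset.sum_le_sum_of_subset_of_nonneg (Finset.filter_subset _ _)
              fun i _ _ => pow_nonneg (by linarith) i
        _ ≤ 2 * W := by rw [Finset.sum_range_succ]; linarith [hgeo M]
    · rw [Finset.range_add_one, Finset.filter_insert, if_neg h]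
      exact ih

theorem exists_dyadic_shell {g : ℝ} (hg : 0 < g) (hg2 : g ≤ 2) :
    ∃ i : ℕ, (1 / 2 : ℝ) ^ i < g ∧ g ≤ 2 * (1 / 2 : ℝ) ^ i := by
  classical
  have hex : ∃ i : ℕ, (1 / 2 : ℝ) ^ i < g := exists_pow_lt_of_lt_one hg (by norm_num)
  refine ⟨Nat.find hex, Nat.find_spec hex, ?_⟩
  rcases h : Nat.find hex with _ | k
  · simpa using hg2
  · have := Nat.find_min hex (m := k) (by omega)
    rw [not_lt] at this
    rw [pow_succ]; linarith

open Classical in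
theorem sum_gap_le [Nonempty X] (hv : BddAbove (range v))
    (hD : ∀ a, D a a = 0) (hLip : ∀ a b, |v a - v b| ≤ D a b) (hgap : ∀ a, gap v a ≤ 2)
    (hB : 4 ≤ B) (hstep : ∀ t < T, IsZoomStep D B t x R (x t)) (hclean : IsClean B v x R T)
    {c z : ℝ} (hc : 0 < c) (hz : z ∈ zoomingExponents D v c) {δ : ℝ} (hδ : 0 < δ) :
    ∑ t ∈ Finset.range T, gap v (x t) ≤ 2 * δ * T + 20 * B * c * δ ^ (-(z + 1)) := by
  obtain ⟨hz0, hcov⟩ := hz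
  obtain ⟨M, hM⟩ := exists_pow_lt_of_lt_one hδ (by norm_num : (1 / 2 : ℝ) < 1)
  -- The shell at `r = 2^(-i)` costs a multiple of `r^(-(z+1)) = b ^ i`. Only shells with `b ^ i ≤
  -- W` matter, and as `b ≥ 2` their geometric sum is at most `2 W`, with no factor for the number
  -- of shells.
  set b : ℝ := (1 / 2 : ℝ) ^ (-(z + 1)) with hb
  have hb2 : 2 ≤ b := by
    rw [hb, one_div, Real.inv_rpow (by norm_num), Real.rpow_neg (by norm_num), inv_inv]
    calc (2 : ℝ) = 2 ^ (1 : ℝ) := by simp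
      _ ≤ 2 ^ (z + 1) := Real.rpow_le_rpow_of_exponent_le (by norm_num) (by linarith)
  have hbpow : ∀ i : ℕ, ((1 / 2 : ℝ) ^ i) ^ (-(z + 1)) = b ^ i := fun i => by
    rw [hb, Real.rpow_pow_comm (by norm_num)]
  set W : ℝ := δ ^ (-(z + 1)) with hWdef
  have hW : 0 ≤ W := Real.rpow_nonneg hδ.le _
  set F := (Finset.range M).filter fun i => b ^ i ≤ W with hF
  have hpoint : ∀ t ∈ Finset.range T, gap v (x t) ≤ 2 * δ
      + ∑ i ∈ F, if x t ∈ gapShell v ((1 / 2 : ℝ) ^ i) then gap v (x t) else 0 := by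
    intro t _
    have hg0 := gap_nonneg hv (x t)
    have hnn : ∀ i ∈ F, (0 : ℝ) ≤ if x t ∈ gapShell v ((1 / 2 : ℝ) ^ i) then gap v (x t) else 0 :=
      fun i _ => by split_ifs <;> simp [hg0]
    by_cases hsmall : gap v (x t) ≤ 2 * δ
    · linarith [Finset.sum_nonneg hnn]
    · rw [not_le] at hsmall
      obtain ⟨i, hi1, hi2⟩ := exists_dyadic_shell (by linarith) (hgap (x t))
      have hδi : δ < (1 / 2 : ℝ) ^ i := by linarith
      have hiF : i ∈ F := by
        rw [hF, Finset.mem_filter, Finset.mem_range]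
        refine ⟨?_, ?_⟩
        · by_contra hle
          have := pow_le_pow_of_le_one (by norm_num : (0 : ℝ) ≤ 1 / 2) (by norm_num)
            (not_lt.1 hle)
          linarith
        · rw [← hbpow]
          exact Real.rpow_le_rpow_of_nonpos hδ hδi.le (by linarith)
      have := Finset.single_le_sum hnn hiF
      rw [if_pos (show x t ∈ gapShell v ((1 / 2 : ℝ) ^ i) from ⟨hi1, hi2⟩)] at this
      linarith
  refine (Finset.sum_le_sum hpoint).trans ?_
  rw [Finset.sum_add_distrib, Finset.sum_const, Finset.card_range, nsmul_eq_mul, Finset.sum_comm]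
  have hshell : ∀ i ∈ F, ∑ t ∈ Finset.range T,
      (if x t ∈ gapShell v ((1 / 2 : ℝ) ^ i) then gap v (x t) else 0) ≤ 10 * B * c * b ^ i := by
    intro i _
    rw [← Finset.sum_filter]
    have hr : (0 : ℝ) < (1 / 2 : ℝ) ^ i := by positivity
    obtain ⟨n, hn, hcn⟩ := hcov ((1 / 2 : ℝ) ^ i)
      ⟨hr, pow_le_one₀ (by norm_num) (by norm_num)⟩
    refine (sum_gap_shell_le hv hD hLip hgap hB hstep hclean hr hcn).trans ?_
    have hB0 : 0 ≤ 10 * B / (1 / 2 : ℝ) ^ i := div_nonneg (by linarith) hr.le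
    refine (mul_le_mul_of_nonneg_right hn hB0).trans (le_of_eq ?_)
    rw [← hbpow, show -(z + 1) = -z - 1 by ring, Real.rpow_sub_one hr.ne']
    ring
  have hsum : ∑ i ∈ F, 10 * B * c * b ^ i ≤ 10 * B * c * (2 * W) := by
    rw [← Finset.mul_sum]
    exact mul_le_mul_of_nonneg_left (sum_pow_filter_le hb2 hW M) (by positivity)
  linarith [Finset.sum_le_sum hshell]

/-- The infimum is attained: for fixed `r` the least covering number does not depend on the
exponent, so its bound passes to the limit along exponents tending to the infimum. -/
theorem zoomingDim_mem_zoomingExponents {c : ℝ} (h : (zoomingExponents D v c).Nonempty) :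
    zoomingDim D v c ∈ zoomingExponents D v c := by
  classical
  have hbdd : BddBelow (zoomingExponents D v c) := ⟨0, fun d hd => hd.1⟩
  refine ⟨le_csInf h fun d hd => hd.1, fun r hr => ?_⟩
  have hex : ∃ n, CoverableBy D (gapShell v r) (r / 8) n := by
    obtain ⟨d, hd⟩ := h
    obtain ⟨n, -, hn⟩ := hd.2 r hr
    exact ⟨n, hn⟩
  refine ⟨Nat.find hex, ?_, Nat.find_spec hex⟩
  obtain ⟨d, -, hlim, hd⟩ := exists_seq_tendsto_sInf h hbdd
  have hcont : Filter.Tendsto (fun k => c * r ^ (-d k)) Filter.atTop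
      (nhds (c * r ^ (-zoomingDim D v c))) :=
    ((Real.continuousAt_const_rpow hr.1.ne').tendsto.comp hlim.neg).const_mul c
  refine ge_of_tendsto' hcont fun k => ?_
  obtain ⟨n, hn, hcn⟩ := (hd k).2 r hr
  exact le_trans (by exact_mod_cast Nat.find_min' hex hcn) hn

end ZoomingAlgorithm

/-! ### Sequences of observations generated by a policy -/

section Sequences

variable {Y : Type*} [Nonempty Y]

/-- Extension of a finite sequence by an arbitrary constant. -/
def extendSeq {T : ℕ} (y : Fin T → Y) (i : ℕ) : Y :=
  if h : i < T then y ⟨i, h⟩ else Classical.arbitrary Y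

theorem extendSeq_apply {T : ℕ} (y : Fin T → Y) (i : Fin T) : extendSeq y i = y i := by
  simp [extendSeq]

theorem extendSeq_snoc {T : ℕ} (y : Fin T → Y) (k : Y) :
    extendSeq (Fin.snoc (α := fun _ => Y) y k) = Function.update (extendSeq y) T k := by
  funext i
  rcases lt_trichotomy i T with h | rfl | h
  · rw [Function.update_of_ne h.ne, extendSeq, extendSeq, dif_pos (by omega), dif_pos h]
    exact Fin.snoc_castSucc (α := fun _ => Y) k y ⟨i, h⟩
  · rw [Function.update_self, extendSeq, dif_pos (Nat.lt_succ_self _)]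
    exact Fin.snoc_last (α := fun _ => Y) k y
  · rw [Function.update_of_ne h.ne', extendSeq, extendSeq, dif_neg (by omega), dif_neg (by omega)]

theorem sum_prod_extendSeq_succ [Fintype Y] {w : ℕ → (ℕ → Y) → ℝ}
    (hloc : ∀ t y y', (∀ i ≤ t, y i = y' i) → w t y = w t y') (T : ℕ) :
    ∑ y : Fin (T + 1) → Y, ∏ t ∈ Finset.range (T + 1), w t (extendSeq y)
      = ∑ y : Fin T → Y, (∏ t ∈ Finset.range T, w t (extendSeq y))
          * ∑ k, w T (Function.update (extendSeq y) T k) := by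
  rw [← (Fin.snocEquiv fun _ => Y).sum_comp, Fintype.sum_prod_type_right]
  refine Finset.sum_congr rfl fun y _ => ?_
  rw [Finset.mul_sum]
  refine Finset.sum_congr rfl fun k _ => ?_
  have : (Fin.snocEquiv fun _ => Y) (k, y) = Fin.snoc (α := fun _ => Y) y k := rfl
  rw [this, extendSeq_snoc, Finset.prod_range_succ]
  congr 1
  refine Finset.prod_congr rfl fun t ht => hloc _ _ _ fun i hi => ?_
  rw [Function.update_of_ne]
  have := Finset.mem_range.1 ht
  omega

/-- A discrete supermartingale bound: the weight of each round, summed over that round's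
observation, is at most 1 whatever the past, so rounds can be peeled off from the last. -/
theorem sum_prod_extendSeq_le_one [Fintype Y] {w : ℕ → (ℕ → Y) → ℝ}
    (hloc : ∀ t y y', (∀ i ≤ t, y i = y' i) → w t y = w t y') (h0 : ∀ t y, 0 ≤ w t y)
    (h1 : ∀ t y, ∑ k, w t (Function.update y t k) ≤ 1) (T : ℕ) :
    ∑ y : Fin T → Y, ∏ t ∈ Finset.range T, w t (extendSeq y) ≤ 1 := by
  induction T with
  | zero => simp
  | succ T ih =>
    rw [sum_prod_extendSeq_succ hloc]
    refine le_trans (Finset.sum_le_sum fun y _ => ?_) ih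
    exact mul_le_of_le_one_right (Finset.prod_nonneg fun t _ => h0 _ _) (h1 _ _)

theorem sum_prod_extendSeq_eq_one [Fintype Y] {w : ℕ → (ℕ → Y) → ℝ}
    (hloc : ∀ t y y', (∀ i ≤ t, y i = y' i) → w t y = w t y')
    (h1 : ∀ t y, ∑ k, w t (Function.update y t k) = 1) (T : ℕ) :
    ∑ y : Fin T → Y, ∏ t ∈ Finset.range T, w t (extendSeq y) = 1 := by
  induction T with
  | zero => simp
  | succ T ih => rw [sum_prod_extendSeq_succ hloc]; simpa only [h1, mul_one] using ih

end Sequences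

/-! ### Concentration of the empirical means -/

section Concentration

/-- Hoeffding's lemma for values in `[-1, 1]`, applied to the measure with point masses `q`. -/
theorem sum_mul_exp_le {Y : Type*} [Fintype Y] {q f : Y → ℝ} (hq : ∀ k, 0 ≤ q k)
    (hq1 : ∑ k, q k = 1) (hf : ∀ k, |f k| ≤ 1) (l : ℝ) :
    ∑ k, q k * Real.exp (l * (f k - ∑ i, q i * f i)) ≤ Real.exp (l ^ 2 / 2) := by
  let _ : MeasurableSpace Y := ⊤
  let μ : Measure Y := ∑ k, ENNReal.ofReal (q k) • Measure.dirac k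
  have hμ : IsProbabilityMeasure μ := ⟨by
    simp only [μ, Measure.coe_finsetSum, Measure.coe_smul, Finset.sum_apply, Pi.smul_apply,
      smul_eq_mul, measure_univ, mul_one]
    rw [← ENNReal.ofReal_sum_of_nonneg fun k _ => hq k, hq1, ENNReal.ofReal_one]⟩
  have hint : ∀ g : Y → ℝ, ∫ y, g y ∂μ = ∑ k, q k * g k := by
    intro g
    rw [integral_finsetSum_measure fun k _ => ?_]
    · refine Finset.sum_congr rfl fun k _ => ?_
      rw [integral_smul_measure, integral_dirac, ENNReal.toReal_ofReal (hq k), smul_eq_mul]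
    · exact (integrable_dirac (by finiteness)).smul_measure ENNReal.ofReal_ne_top
  have h := (ProbabilityTheory.hasSubgaussianMGF_of_mem_Icc (μ := μ) (X := f) (a := -1) (b := 1)
    (measurable_of_finite f).aemeasurable
    (Filter.Eventually.of_forall fun k => abs_le.1 (hf k))).mgf_le l
  rw [ProbabilityTheory.mgf, hint, hint] at h
  refine h.trans (le_of_eq ?_)
  norm_num

/-- The arm pulled first in round `t₀` has been pulled `n` times before round `t`, and its empirical
mean deviates from its mean in direction `σ` by more than the confidence radius. -/
def deviates {X : Type*} (B : ℝ) (v : X → ℝ) (x : ℕ → X) (R : ℕ → ℝ) (t t₀ n : ℕ) (σ : ℝ) : Prop :=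
  t₀ < t ∧ (∀ i < t₀, x i ≠ x t₀) ∧ pulls x t (x t₀) = n ∧
    √(B * n) < σ * (gain x R t (x t₀) - n * v (x t₀))

theorem exists_deviates_of_not_isClean {X : Type*} {B : ℝ} {v : X → ℝ} {x : ℕ → X} {R : ℕ → ℝ} {T : ℕ}
    (h : ¬IsClean B v x R T) :
    ∃ t < T, ∃ t₀ < T, ∃ n < T, deviates B v x R t t₀ n 1 ∨ deviates B v x R t t₀ n (-1) := by
  unfold IsClean at h
  push Not at h
  obtain ⟨t, ht, i, hi, hlt⟩ := h
  obtain ⟨t₀, ht₀, hx, hfirst⟩ := exists_first_pull (x := x) (j := i)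
  rw [← hx] at hlt
  have hn : pulls x t (x t₀) ≤ t := by
    refine (Finset.card_le_card (t := Finset.range t) fun j hj => ?_).trans
      (Finset.card_range t).le
    exact Finset.mem_range.2 (mem_pullTimes.1 hj).1
  refine ⟨t, ht, t₀, by omega, _, hn.trans_lt ht, ?_⟩
  rcases lt_abs.1 hlt with h | h
  · exact Or.inl ⟨by omega, hfirst, rfl, by rwa [one_mul]⟩
  · exact Or.inr ⟨by omega, hfirst, rfl, by rwa [neg_one_mul]⟩

variable {X Y : Type*} [Nonempty X]

/-- The probability of the sequence `y` of observations under the zooming algorithm if arm `a`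
produces observation `k` with probability `q a k`. -/
def zoomProb [Nonempty Y] (D : X → X → ℝ) (B : ℝ) (rew q : X → Y → ℝ) {T : ℕ} (y : Fin T → Y) : ℝ :=
  ∏ t ∈ Finset.range T, q (zoomArm D B rew (extendSeq y) t) (extendSeq y t)

variable {D : X → X → ℝ} {B : ℝ} {rew q : X → Y → ℝ}

theorem zoomProb_nonneg [Nonempty Y] (hq : ∀ a k, 0 ≤ q a k) {T : ℕ} (y : Fin T → Y) :
    0 ≤ zoomProb D B rew q y :=
  Finset.prod_nonneg fun _ _ => hq _ _

theorem zoomArm_update (y : ℕ → Y) (t : ℕ) (k : Y) {i : ℕ} (hi : i ≤ t) :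
    zoomArm D B rew (Function.update y t k) i = zoomArm D B rew y i :=
  zoomArm_congr _ _ _ _ fun j hj => Function.update_of_ne (by omega) _ _

variable [Nonempty Y] [Fintype Y]

theorem sum_zoomProb (hq1 : ∀ a, ∑ k, q a k = 1) (T : ℕ) :
    ∑ y : Fin T → Y, zoomProb D B rew q y = 1 := by
  refine sum_prod_extendSeq_eq_one (w := fun t y => q (zoomArm D B rew y t) (y t)) ?_ ?_ T
  · intro t y y' h
    rw [zoomArm_congr D B rew t fun i hi => h i hi.le, h t le_rfl]
  · intro t y
    simp only [zoomArm_update y t _ le_rfl, Function.update_self, hq1]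

open Classical in
-- Chernoff's method under adaptive sampling. There may be infinitely many arms, so the arm is named
-- by its first round `t₀`; from then on it is determined by the past. Fixing `n` makes the tilt `l`
-- deterministic.
theorem sum_zoomProb_deviates_le (hB : 0 < B) (hq : ∀ a k, 0 ≤ q a k)
    (hq1 : ∀ a, ∑ k, q a k = 1) (hrew : ∀ a k, |rew a k| ≤ 1) {v : X → ℝ}
    (hv : ∀ a, v a = ∑ k, q a k * rew a k) {T t : ℕ} (ht : t < T) (t₀ n : ℕ) {σ : ℝ}
    (hσ : σ ^ 2 = 1) :
    ∑ y : Fin T → Y, zoomProb D B rew q y *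
      (if deviates B v (zoomArm D B rew (extendSeq y))
          (fun i => rew (zoomArm D B rew (extendSeq y) i) (extendSeq y i)) t t₀ n σ then 1 else 0)
      ≤ Real.exp (-(B / 2)) := by
  set l : ℝ := radius B n with hl
  -- Only pulls of the chosen arm are tilted; subtracting `l ^ 2 / 2` makes each tilted kernel have
  -- mass at most 1 by Hoeffding. The condition `t₀ ≤ i` keeps `φ i` independent of observations
  -- after round `i`.
  set φ : ℕ → (ℕ → Y) → ℝ := fun i y =>
    if t₀ ≤ i ∧ i < t ∧ zoomArm D B rew y i = zoomArm D B rew y t₀ then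
      l * σ * (rew (zoomArm D B rew y i) (y i) - v (zoomArm D B rew y i)) - l ^ 2 / 2 else 0
    with hφ
  set w : ℕ → (ℕ → Y) → ℝ := fun i y => q (zoomArm D B rew y i) (y i) * Real.exp (φ i y) with hw
  have hle : ∑ y : Fin T → Y, ∏ i ∈ Finset.range T, w i (extendSeq y) ≤ 1 := by
    refine sum_prod_extendSeq_le_one (w := w) ?_ (fun i y => mul_nonneg (hq _ _) (Real.exp_pos _).le) ?_ T
    · intro i y y' h
      have hx : ∀ j ≤ i, zoomArm D B rew y j = zoomArm D B rew y' j :=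
        fun j hj => zoomArm_congr _ _ _ _ fun k hk => h k (by omega)
      by_cases hi : t₀ ≤ i
      · simp only [hw, hφ, hx i le_rfl, h i le_rfl, hx t₀ hi]
      · simp only [hw, hφ, hi, false_and, if_false, hx i le_rfl, h i le_rfl]
    · intro i y
      set a := zoomArm D B rew y i with ha
      by_cases hi : t₀ ≤ i
      · simp only [hw, hφ, zoomArm_update y i _ le_rfl, zoomArm_update y i _ hi,
          Function.update_self, ← ha]
        by_cases hc : t₀ ≤ i ∧ i < t ∧ a = zoomArm D B rew y t₀
        · simp only [if_pos hc, Real.exp_sub, ← mul_div_assoc]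
          rw [← Finset.sum_div, div_le_one (Real.exp_pos _)]
          have := sum_mul_exp_le (hq a) (hq1 a) (hrew a) (l * σ)
          rwa [← hv, mul_pow, hσ, mul_one] at this
        · simp only [if_neg hc, Real.exp_zero, mul_one, hq1, le_refl]
      · simp only [hw, hφ, hi, false_and, if_false, zoomArm_update y i _ le_rfl,
          Function.update_self, Real.exp_zero, mul_one, hq1, le_refl]
  have hpoint : ∀ y : Fin T → Y, zoomProb D B rew q y *
      (if deviates B v (zoomArm D B rew (extendSeq y))
          (fun i => rew (zoomArm D B rew (extendSeq y) i) (extendSeq y i)) t t₀ n σ then 1 else 0)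
      ≤ Real.exp (-(B / 2)) * ∏ i ∈ Finset.range T, w i (extendSeq y) := by
    intro y
    have hp0 := zoomProb_nonneg (D := D) (B := B) (rew := rew) hq y
    have hw' : ∏ i ∈ Finset.range T, w i (extendSeq y)
        = zoomProb D B rew q y * Real.exp (∑ i ∈ Finset.range T, φ i (extendSeq y)) := by
      rw [hw, Finset.prod_mul_distrib, Real.exp_sum, zoomProb]
    rw [hw']
    split_ifs with hdev
    · obtain ⟨h1, h2, h3, h4⟩ := hdev
      set x := zoomArm D B rew (extendSeq y) with hx
      have hn : 0 < n := h3 ▸ pulls_pos h1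
      have hn' : (0 : ℝ) < n := Nat.cast_pos.2 hn
      have hsum : ∑ i ∈ Finset.range T, φ i (extendSeq y)
          = l * (σ * (gain x (fun i => rew (x i) (extendSeq y i)) t (x t₀) - n * v (x t₀)))
            - n * l ^ 2 / 2 := by
        rw [hφ]
        simp only [← hx]
        rw [← Finset.sum_filter]
        have hfil : (Finset.range T).filter (fun i => t₀ ≤ i ∧ i < t ∧ x i = x t₀)
            = pullTimes x t (x t₀) := by
          ext i
          rw [Finset.mem_filter, Finset.mem_range, mem_pullTimes]
          refine ⟨fun h => h.2.2, fun h => ⟨by omega, ?_, h⟩⟩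
          by_contra hlt
          exact h2 i (not_le.1 hlt) h.2
        rw [hfil]
        have hcongr : ∀ i ∈ pullTimes x t (x t₀),
            l * σ * (rew (x i) (extendSeq y i) - v (x i)) - l ^ 2 / 2
            = l * σ * rew (x i) (extendSeq y i) - (l * σ * v (x t₀) + l ^ 2 / 2) := by
          intro i hi
          rw [(mem_pullTimes.1 hi).2]; ring
        rw [Finset.sum_congr rfl hcongr, Finset.sum_sub_distrib, ← Finset.mul_sum,
          Finset.sum_const, nsmul_eq_mul]
        change _ - ((pulls x t (x t₀) : ℕ) : ℝ) * _ = _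
        rw [h3, gain]; ring
      have hl0 : 0 ≤ l := radius_nonneg _ _
      have hl2 : l ^ 2 = B / n := Real.sq_sqrt (by positivity)
      have hmul : l * √(B * n) = B := by
        rw [← mul_radius hB.le, ← hl, mul_left_comm, ← sq, hl2]; field_simp
      -- The choice `l = √(B / n)` turns a deviation above `√(B n)` into an exponent of at least `B
      -- - B / 2`.
      have hexp : B / 2 ≤ ∑ i ∈ Finset.range T, φ i (extendSeq y) := by
        rw [hsum]
        have h5 := mul_le_mul_of_nonneg_left h4.le hl0
        rw [hmul] at h5
        have h6 : n * l ^ 2 / 2 = B / 2 := by rw [hl2]; field_simp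
        linarith
      have h7 : 1 ≤ Real.exp (-(B / 2)) * Real.exp (∑ i ∈ Finset.range T, φ i (extendSeq y)) := by
        rw [← Real.exp_add]
        exact Real.one_le_exp (by linarith)
      nlinarith
    · rw [mul_zero]
      exact mul_nonneg (Real.exp_pos _).le (mul_nonneg hp0 (Real.exp_pos _).le)
  refine (Finset.sum_le_sum fun y _ => hpoint y).trans ?_
  rw [← Finset.mul_sum]
  exact mul_le_of_le_one_right (Real.exp_pos _).le hle

open Classical in
theorem sum_zoomProb_not_isClean_le (hB : 0 < B) (hq : ∀ a k, 0 ≤ q a k)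
    (hq1 : ∀ a, ∑ k, q a k = 1) (hrew : ∀ a k, |rew a k| ≤ 1) {v : X → ℝ}
    (hv : ∀ a, v a = ∑ k, q a k * rew a k) (T : ℕ) :
    ∑ y : Fin T → Y, zoomProb D B rew q y *
      (if IsClean B v (zoomArm D B rew (extendSeq y))
          (fun i => rew (zoomArm D B rew (extendSeq y) i) (extendSeq y i)) T then 0 else 1)
      ≤ 2 * T ^ 3 * Real.exp (-(B / 2)) := by
  set dev : (Fin T → Y) → ℕ → ℕ → ℕ → ℝ → ℝ := fun y t t₀ n σ =>
    if deviates B v (zoomArm D B rew (extendSeq y))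
      (fun i => rew (zoomArm D B rew (extendSeq y) i) (extendSeq y i)) t t₀ n σ then 1 else 0
    with hdev
  have hdev0 : ∀ y t t₀ n σ, 0 ≤ dev y t t₀ n σ := fun y t t₀ n σ => by
    simp only [hdev]; split_ifs <;> norm_num
  have hpoint : ∀ y : Fin T → Y, (if IsClean B v (zoomArm D B rew (extendSeq y))
      (fun i => rew (zoomArm D B rew (extendSeq y) i) (extendSeq y i)) T then (0 : ℝ) else 1)
      ≤ ∑ t ∈ Finset.range T, ∑ t₀ ∈ Finset.range T, ∑ n ∈ Finset.range T,
        (dev y t t₀ n 1 + dev y t t₀ n (-1)) := by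
    intro y
    have h0 : ∀ t t₀ n, 0 ≤ dev y t t₀ n 1 + dev y t t₀ n (-1) :=
      fun t t₀ n => add_nonneg (hdev0 _ _ _ _ _) (hdev0 _ _ _ _ _)
    split_ifs with hcl
    · exact Finset.sum_nonneg fun t _ => Finset.sum_nonneg fun t₀ _ =>
        Finset.sum_nonneg fun n _ => h0 t t₀ n
    · obtain ⟨t, ht, t₀, ht₀, n, hn, h⟩ := exists_deviates_of_not_isClean hcl
      have h1 : 1 ≤ dev y t t₀ n 1 + dev y t t₀ n (-1) := by
        rcases h with h | h
        · have : dev y t t₀ n 1 = 1 := if_pos h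
          linarith [hdev0 y t t₀ n (-1)]
        · have : dev y t t₀ n (-1) = 1 := if_pos h
          linarith [hdev0 y t t₀ n 1]
      refine h1.trans ?_
      refine le_trans ?_ (Finset.single_le_sum (f := fun t => ∑ t₀ ∈ Finset.range T,
        ∑ n ∈ Finset.range T, (dev y t t₀ n 1 + dev y t t₀ n (-1)))
        (fun t _ => Finset.sum_nonneg fun t₀ _ => Finset.sum_nonneg fun n _ => h0 t t₀ n)
        (Finset.mem_range.2 ht))
      refine le_trans ?_ (Finset.single_le_sum (f := fun t₀ =>
        ∑ n ∈ Finset.range T, (dev y t t₀ n 1 + dev y t t₀ n (-1)))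
        (fun t₀ _ => Finset.sum_nonneg fun n _ => h0 t t₀ n) (Finset.mem_range.2 ht₀))
      exact Finset.single_le_sum (f := fun n => dev y t t₀ n 1 + dev y t t₀ n (-1))
        (fun n _ => h0 t t₀ n) (Finset.mem_range.2 hn)
  calc _ ≤ ∑ y : Fin T → Y, zoomProb D B rew q y * ∑ t ∈ Finset.range T,
        ∑ t₀ ∈ Finset.range T, ∑ n ∈ Finset.range T, (dev y t t₀ n 1 + dev y t t₀ n (-1)) :=
        Finset.sum_le_sum fun y _ =>
          mul_le_mul_of_nonneg_left (hpoint y) (zoomProb_nonneg hq y)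
    _ = ∑ t ∈ Finset.range T, ∑ t₀ ∈ Finset.range T, ∑ n ∈ Finset.range T,
        (∑ y : Fin T → Y, zoomProb D B rew q y * dev y t t₀ n 1
          + ∑ y : Fin T → Y, zoomProb D B rew q y * dev y t t₀ n (-1)) := by
        simp_rw [Finset.mul_sum]
        rw [Finset.sum_comm]
        refine Finset.sum_congr rfl fun t _ => ?_
        rw [Finset.sum_comm]
        refine Finset.sum_congr rfl fun t₀ _ => ?_
        rw [Finset.sum_comm]
        refine Finset.sum_congr rfl fun n _ => ?_
        rw [← Finset.sum_add_distrib]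
        exact Finset.sum_congr rfl fun y _ => mul_add _ _ _
    _ ≤ ∑ t ∈ Finset.range T, ∑ t₀ ∈ Finset.range T, ∑ n ∈ Finset.range T,
        2 * Real.exp (-(B / 2)) := by
        refine Finset.sum_le_sum fun t ht => Finset.sum_le_sum fun t₀ _ =>
          Finset.sum_le_sum fun n _ => ?_
        have h1 := sum_zoomProb_deviates_le (D := D) hB hq hq1 hrew hv (Finset.mem_range.1 ht)
          t₀ n (σ := 1) (by norm_num)
        have h2 := sum_zoomProb_deviates_le (D := D) hB hq hq1 hrew hv (Finset.mem_range.1 ht)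
          t₀ n (σ := -1) (by norm_num)
        linarith
    _ = 2 * T ^ 3 * Real.exp (-(B / 2)) := by
        simp only [Finset.sum_const, Finset.card_range, nsmul_eq_mul]; ring

theorem sum_zoomProb_mul_sum_gap_le (hq : ∀ a k, 0 ≤ q a k) (hq1 : ∀ a, ∑ k, q a k = 1)
    (hrew : ∀ a k, |rew a k| ≤ 1) {v : X → ℝ} (hv : ∀ a, v a = ∑ k, q a k * rew a k)
    (hbdd : BddAbove (range v)) (hD : ∀ a, D a a = 0) (hLip : ∀ a b, |v a - v b| ≤ D a b)
    (hgap : ∀ a, gap v a ≤ 2) {T : ℕ} (hT : 2 ≤ T) (hBT : B = 8 * Real.log T)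
    {c z : ℝ} (hc : 0 < c) (hz : z ∈ zoomingExponents D v c) {δ : ℝ} (hδ : 0 < δ) :
    ∑ y : Fin T → Y, zoomProb D B rew q y *
        ∑ t ∈ Finset.range T, gap v (zoomArm D B rew (extendSeq y) t)
      ≤ 2 * δ * T + 20 * B * c * δ ^ (-(z + 1)) + 4 := by
  classical
  have hT' : (2 : ℝ) ≤ T := by exact_mod_cast hT
  have hlog : Real.log 2 ≤ Real.log T := Real.log_le_log (by norm_num) hT'
  have hB : 4 ≤ B := by rw [hBT]; linarith [Real.log_two_gt_d9]
  set M := 2 * δ * T + 20 * B * c * δ ^ (-(z + 1)) with hM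
  have hM0 : 0 ≤ M := by
    have := Real.rpow_nonneg hδ.le (-(z + 1))
    have hB0 : 0 ≤ B := by linarith
    positivity
  have hpoint : ∀ y : Fin T → Y,
      ∑ t ∈ Finset.range T, gap v (zoomArm D B rew (extendSeq y) t) ≤ M + 2 * T *
      (if IsClean B v (zoomArm D B rew (extendSeq y))
          (fun i => rew (zoomArm D B rew (extendSeq y) i) (extendSeq y i)) T then 0 else 1) := by
    intro y
    split_ifs with hcl
    · rw [mul_zero, add_zero]
      exact sum_gap_le hbdd hD hLip hgap hB (fun t _ => isZoomStep_zoomArm D B rew _ t) hcl hc hz hδ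
    · have : ∑ t ∈ Finset.range T, gap v (zoomArm D B rew (extendSeq y) t)
          ≤ ∑ t ∈ Finset.range T, (2 : ℝ) := Finset.sum_le_sum fun t _ => hgap _
      rw [Finset.sum_const, Finset.card_range, nsmul_eq_mul] at this
      linarith
  have hfail := sum_zoomProb_not_isClean_le (D := D) (B := B) (by linarith) hq hq1 hrew hv T
  -- With `B = 8 log T` the bad event has probability at most `2 T³ / T⁴`; at regret at most `2 T`
  -- it contributes at most 4.
  have hexp : Real.exp (-(B / 2)) = ((T : ℝ) ^ 4)⁻¹ := by
    rw [hBT, Real.exp_neg, show 8 * Real.log T / 2 = (4 : ℕ) * Real.log T by push_cast; ring,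
      Real.exp_nat_mul, Real.exp_log (by linarith)]
  calc _ ≤ ∑ y : Fin T → Y, zoomProb D B rew q y * (M + 2 * T *
      (if IsClean B v (zoomArm D B rew (extendSeq y))
          (fun i => rew (zoomArm D B rew (extendSeq y) i) (extendSeq y i)) T then 0 else 1)) :=
        Finset.sum_le_sum fun y _ =>
          mul_le_mul_of_nonneg_left (hpoint y) (zoomProb_nonneg hq y)
    _ = M + 2 * T * ∑ y : Fin T → Y, zoomProb D B rew q y *
      (if IsClean B v (zoomArm D B rew (extendSeq y))
          (fun i => rew (zoomArm D B rew (extendSeq y) i) (extendSeq y i)) T then 0 else 1) := by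
        simp_rw [mul_add, Finset.sum_add_distrib, ← Finset.sum_mul, sum_zoomProb hq1, one_mul,
          Finset.mul_sum]
        congr 1
        exact Finset.sum_congr rfl fun y _ => by ring
    _ ≤ M + 2 * T * (2 * T ^ 3 * Real.exp (-(B / 2))) := by gcongr
    _ = M + 4 := by
        rw [hexp]
        have : (T : ℝ) ≠ 0 := by positivity
        field_simp
        ring

end Concentration

/-! ### Covering the contracts -/

theorem two_le_lipConst {lam mu : ℝ} (hlam : mu < lam) (L : ℝ) : 2 ≤ lipConst lam mu L := by
  have : 0 ≤ 4 * L ^ 2 / (lam - mu) := div_nonneg (by positivity) (sub_nonneg.2 hlam.le)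
  rw [lipConst]; linarith

theorem coverableBy_contractDist {m : ℕ} {K h : ℝ} (hK : 0 ≤ K) (hh : 0 < h)
    (A : Set (Contract m)) :
    CoverableBy (contractDist K) A (K * (m * h)) ((⌊1 / h⌋₊ + 1) ^ m) := by
  have hcard : Fintype.card (Fin m → Fin (⌊1 / h⌋₊ + 1)) = (⌊1 / h⌋₊ + 1) ^ m := by simp
  let e := Fintype.equivFinOfCardEq hcard
  refine ⟨fun i => {s | ∀ j, ⌊s.pay j / h⌋₊ = (e.symm i j).1}, fun s _ => ?_, ?_⟩
  · have hlt : ∀ j, ⌊s.pay j / h⌋₊ < ⌊1 / h⌋₊ + 1 := fun j => by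
      refine Nat.lt_succ_of_le (Nat.floor_le_floor ?_)
      exact div_le_div_of_nonneg_right (s.2.2.2 j) hh.le
    refine mem_iUnion.2 ⟨e fun j => ⟨_, hlt j⟩, fun j => ?_⟩
    rw [Equiv.symm_apply_apply]
  · intro i s hs s' hs'
    refine mul_le_mul_of_nonneg_left ?_ hK
    calc ∑ j, |s.pay j - s'.pay j| ≤ ∑ _j : Fin m, h := by
          refine Finset.sum_le_sum fun j _ => ?_
          have h0 : 0 ≤ s.pay j / h := div_nonneg (s.2.1 j) hh.le
          have h0' : 0 ≤ s'.pay j / h := div_nonneg (s'.2.1 j) hh.le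
          have h1 := Nat.floor_le h0
          have h2 := Nat.lt_floor_add_one (s.pay j / h)
          have h1' := Nat.floor_le h0'
          have h2' := Nat.lt_floor_add_one (s'.pay j / h)
          rw [hs j] at h1 h2
          rw [hs' j] at h1' h2'
          have h3 : |s.pay j / h - s'.pay j / h| ≤ 1 := by
            rw [abs_le]; constructor <;> linarith
          rwa [← sub_div, abs_div, abs_of_pos hh, div_le_one hh] at h3
      _ = m * h := by simp

/-- A grid of mesh `r / (8 K m)` on the payments has cells of diameter at most `r / 8`, so the
exponent `m` always works. -/
theorem exists_zoomingExponents_nonempty {m : ℕ} [NeZero m] {K : ℝ} (hK : 2 ≤ K)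
    (v : Contract m → ℝ) : ∃ c > 0, (zoomingExponents (contractDist K) v c).Nonempty := by
  have hm : (1 : ℝ) ≤ m := by exact_mod_cast NeZero.one_le
  refine ⟨(16 * K * m) ^ m, by positivity, m, Nat.cast_nonneg m, fun r hr => ?_⟩
  have hr0 := hr.1
  have hpos : 0 < 8 * K * m := by positivity
  refine ⟨(⌊1 / (r / (8 * K * m))⌋₊ + 1) ^ m, ?_, ?_⟩
  · have h1 : (⌊1 / (r / (8 * K * m))⌋₊ : ℝ) ≤ 8 * K * m / r := by
      rw [one_div_div]; exact Nat.floor_le (by positivity)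
    -- This absorbs the extra cell per coordinate, which is why the multiplier has 16 in place of 8.
    have h2 : 1 ≤ 8 * K * m / r := by
      rw [one_le_div hr0]; nlinarith [hr.2]
    push_cast
    rw [Real.rpow_neg hr0.le, Real.rpow_natCast, ← inv_pow, ← mul_pow]
    refine pow_le_pow_left₀ (by positivity) ?_ m
    calc _ ≤ 8 * K * m / r + 8 * K * m / r := add_le_add h1 h2
      _ = 16 * K * m * r⁻¹ := by rw [div_eq_mul_inv]; ring
  · have h := coverableBy_contractDist (K := K) (h := r / (8 * K * m)) (by linarith)
      (by positivity) (gapShell v r)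
    have heq : K * (m * (r / (8 * K * m))) = r / 8 := by
      have : (m : ℝ) ≠ 0 := by positivity
      have : K ≠ 0 := by positivity
      field_simp
    rwa [heq] at h

/-! ### Constant contracts -/

/-- The contract paying `κ` at every outcome level. -/
def constContract (m : ℕ) {κ : ℝ} (hκ : κ ∈ Icc (0 : ℝ) 1) : Contract m :=
  ⟨fun _ => κ, fun _ => hκ.1, monotone_const, fun _ => hκ.2⟩

instance (m : ℕ) : Nonempty (Contract m) := ⟨constContract m (left_mem_Icc.2 zero_le_one)⟩

theorem AgentType.agentUtility_constContract {m : ℕ} {E : ℝ} (θ : AgentType m E) {κ a : ℝ}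
    (hκ : κ ∈ Icc (0 : ℝ) 1) (ha : a ∈ Icc 0 E) :
    θ.agentUtility (constContract m hκ) a = κ - θ.cost a := by
  simp only [AgentType.agentUtility, constContract, Contract.pay]
  rw [← Finset.mul_sum, θ.prob_sum a ha, mul_one]

/-- A constant payment shifts the agent's utility by a constant, so it leaves incentives unchanged.
-/
theorem AgentType.response_constContract {m : ℕ} [NeZero m] {E lam mu L : ℝ}
    {θ : AgentType m E} (hE : 0 < E) (hlam : mu < lam) (h : θ.IsRegular lam mu L) (π : Fin m → ℝ)
    {κ κ' : ℝ} (hκ : κ ∈ Icc (0 : ℝ) 1) (hκ' : κ' ∈ Icc (0 : ℝ) 1) :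
    θ.response π (constContract m hκ) = θ.response π (constContract m hκ') := by
  have h1 := response_mem hE hlam h π (constContract m hκ)
  refine incentiveCompatible_unique hE hlam h (response_mem hE hlam h π (constContract m hκ'))
    ⟨h1.1, fun a ha => ?_⟩
  have h2 := h1.2 a ha
  rw [agentUtility_constContract _ _ ha, agentUtility_constContract _ _ h1.1] at h2 ⊢
  linarith

/-! ### The bandit problem of the principal -/

/-- The probability of outcome level `k` under the contract `s`. -/
def meanProb {m : ℕ} {E : ℝ} {Θ : Type*} [MeasurableSpace Θ] (D : Measure Θ)
    (agent : Θ → AgentType m E) (π : Fin m → ℝ) (s : Contract m) (k : Fin m) : ℝ :=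
  ∫ θ, (agent θ).prob ((agent θ).response π s) k ∂D

/-- The policy of the principal that follows the zooming algorithm. -/
def zoomPolicy {m : ℕ} [NeZero m] (π : Fin m → ℝ) (K : ℝ) (T : ℕ) : Policy m T := fun t h =>
  zoomArm (contractDist K) (8 * Real.log T) (fun s k => π k - s.pay k) (extendSeq h) t

theorem zoomPolicy_posted {m : ℕ} [NeZero m] (π : Fin m → ℝ) (K : ℝ) (T : ℕ) (y : Fin T → Fin m)
    (t : Fin T) : (zoomPolicy π K T).posted y t
      = zoomArm (contractDist K) (8 * Real.log T) (fun s k => π k - s.pay k) (extendSeq y) t := by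
  refine zoomArm_congr _ _ _ _ fun i hi => ?_
  rw [extendSeq, extendSeq, dif_pos hi, dif_pos (hi.trans t.2)]
  rfl

theorem meanProb_nonneg {m : ℕ} [NeZero m] {E lam mu L : ℝ} {Θ : Type*} [MeasurableSpace Θ]
    {D : Measure Θ} {agent : Θ → AgentType m E} {π : Fin m → ℝ} (hE : 0 < E)
    (hlam : mu < lam) (h : ∀ θ, (agent θ).IsRegular lam mu L) (s : Contract m) (k : Fin m) :
    0 ≤ meanProb D agent π s k :=
  integral_nonneg fun θ =>
    (agent θ).prob_nonneg _ (AgentType.response_mem hE hlam (h θ) π s).1 k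

theorem abs_reward_le {m : ℕ} {π : Fin m → ℝ} (hπ0 : ∀ j, 0 ≤ π j) (hπ1 : ∀ j, π j ≤ 1) (s : Contract m) (k : Fin m) :
    |π k - s.pay k| ≤ 1 :=
  abs_sub_le_of_nonneg_of_le (hπ0 k) (hπ1 k) (s.2.1 k) (s.2.2.2 k)

section Bandit

variable {m : ℕ} [NeZero m] {E lam mu L : ℝ} {Θ : Type*} [MeasurableSpace Θ] {D : Measure Θ}
  [IsProbabilityMeasure D] {agent : Θ → AgentType m E} {π : Fin m → ℝ}

theorem integrable_prob_response (hE : 0 < E) (hlam : mu < lam)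
    (hc : ∀ a ∈ Icc 0 E, Measurable fun θ => (agent θ).cost a)
    (hp : ∀ a ∈ Icc 0 E, ∀ j, Measurable fun θ => (agent θ).prob a j)
    (h : ∀ θ, (agent θ).IsRegular lam mu L) (s : Contract m) (k : Fin m) :
    Integrable (fun θ => (agent θ).prob ((agent θ).response π s) k) D := by
  refine Integrable.of_mem_Icc 0 1
    (AgentType.measurable_prob_response hE hlam hc hp h π s k).aemeasurable
    (Filter.Eventually.of_forall fun θ => ?_)
  have := (AgentType.response_mem hE hlam (h θ) π s).1
  exact ⟨(agent θ).prob_nonneg _ this k, (agent θ).prob_le_one this k⟩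

theorem integrable_principalUtility (hE : 0 < E) (hlam : mu < lam)
    (hc : ∀ a ∈ Icc 0 E, Measurable fun θ => (agent θ).cost a)
    (hp : ∀ a ∈ Icc 0 E, ∀ j, Measurable fun θ => (agent θ).prob a j)
    (h : ∀ θ, (agent θ).IsRegular lam mu L) (s : Contract m) :
    Integrable (fun θ => (agent θ).principalUtility π s) D := by
  simp_rw [fun θ => AgentType.principalUtility_eq hE hlam (h θ) π s]
  exact integrable_finsetSum _ fun j _ =>
    (integrable_prob_response hE hlam hc hp h s j).const_mul _

theorem expectedUtility_eq (hE : 0 < E) (hlam : mu < lam)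
    (hc : ∀ a ∈ Icc 0 E, Measurable fun θ => (agent θ).cost a)
    (hp : ∀ a ∈ Icc 0 E, ∀ j, Measurable fun θ => (agent θ).prob a j)
    (h : ∀ θ, (agent θ).IsRegular lam mu L) (s : Contract m) :
    expectedUtility D agent π s = ∑ k, meanProb D agent π s k * (π k - s.pay k) := by
  rw [expectedUtility]
  simp_rw [fun θ => AgentType.principalUtility_eq hE hlam (h θ) π s]
  rw [integral_finsetSum _ fun j _ =>
    (integrable_prob_response hE hlam hc hp h s j).const_mul _]
  refine Finset.sum_congr rfl fun k _ => ?_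
  rw [integral_const_mul, meanProb, mul_comm]

theorem sum_meanProb (hE : 0 < E) (hlam : mu < lam)
    (hc : ∀ a ∈ Icc 0 E, Measurable fun θ => (agent θ).cost a)
    (hp : ∀ a ∈ Icc 0 E, ∀ j, Measurable fun θ => (agent θ).prob a j)
    (h : ∀ θ, (agent θ).IsRegular lam mu L) (s : Contract m) :
    ∑ k, meanProb D agent π s k = 1 := by
  simp_rw [meanProb]
  rw [← integral_finsetSum _ fun k _ => integrable_prob_response hE hlam hc hp h s k]
  simp_rw [fun θ => (agent θ).prob_sum _ (AgentType.response_mem hE hlam (h θ) π s).1]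
  simp

theorem expectedUtility_sub_le (hE : 0 < E) (hlam : mu < lam)
    (hc : ∀ a ∈ Icc 0 E, Measurable fun θ => (agent θ).cost a)
    (hp : ∀ a ∈ Icc 0 E, ∀ j, Measurable fun θ => (agent θ).prob a j)
    (h : ∀ θ, (agent θ).IsRegular lam mu L) (hπ0 : ∀ j, 0 ≤ π j) (hπ : Monotone π)
    (hπ1 : ∀ j, π j ≤ 1) (s s' : Contract m) :
    |expectedUtility D agent π s - expectedUtility D agent π s'|
      ≤ contractDist (lipConst lam mu L) s s' := by
  rw [expectedUtility, expectedUtility,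
    ← integral_sub (integrable_principalUtility hE hlam hc hp h s)
      (integrable_principalUtility hE hlam hc hp h s')]
  have := norm_integral_le_of_norm_le_const (μ := D) (C := contractDist (lipConst lam mu L) s s')
    (f := fun θ => (agent θ).principalUtility π s - (agent θ).principalUtility π s')
    (Filter.Eventually.of_forall fun θ =>
      AgentType.principalUtility_sub_le hE hlam (h θ) hπ0 hπ hπ1 s s')
  simpa using this

theorem abs_expectedUtility_le (hE : 0 < E) (hlam : mu < lam)
    (hc : ∀ a ∈ Icc 0 E, Measurable fun θ => (agent θ).cost a)
    (hp : ∀ a ∈ Icc 0 E, ∀ j, Measurable fun θ => (agent θ).prob a j)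
    (h : ∀ θ, (agent θ).IsRegular lam mu L) (hπ0 : ∀ j, 0 ≤ π j)
    (hπ1 : ∀ j, π j ≤ 1) (s : Contract m) : |expectedUtility D agent π s| ≤ 1 := by
  rw [expectedUtility_eq hE hlam hc hp h, ← sum_meanProb (D := D) (π := π) hE hlam hc hp h s]
  refine (Finset.abs_sum_le_sum_abs _ _).trans (Finset.sum_le_sum fun k _ => ?_)
  have hq := meanProb_nonneg (D := D) (π := π) hE hlam h s k
  rw [abs_mul, abs_of_nonneg hq]
  exact mul_le_of_le_one_right hq (abs_reward_le hπ0 hπ1 s k)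

theorem expectedUtility_constContract (hE : 0 < E) (hlam : mu < lam)
    (hc : ∀ a ∈ Icc 0 E, Measurable fun θ => (agent θ).cost a)
    (hp : ∀ a ∈ Icc 0 E, ∀ j, Measurable fun θ => (agent θ).prob a j)
    (h : ∀ θ, (agent θ).IsRegular lam mu L) {κ κ' : ℝ} (hκ : κ ∈ Icc (0 : ℝ) 1)
    (hκ' : κ' ∈ Icc (0 : ℝ) 1) :
    expectedUtility D agent π (constContract m hκ) + κ
      = expectedUtility D agent π (constContract m hκ') + κ' := by
  have hq : meanProb D agent π (constContract m hκ) = meanProb D agent π (constContract m hκ') := by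
    funext k
    simp_rw [meanProb, fun θ => AgentType.response_constContract hE hlam (h θ) π hκ hκ']
  have hs := sum_meanProb (D := D) (π := π) hE hlam hc hp h (constContract m hκ')
  rw [expectedUtility_eq hE hlam hc hp h, expectedUtility_eq hE hlam hc hp h, hq]
  simp only [constContract, Contract.pay] at hs ⊢
  simp_rw [mul_sub, Finset.sum_sub_distrib, ← Finset.sum_mul, hs]
  ring

/-- Raising a constant payment by `κ` raises the gap by exactly `κ`. The zero contract has gap in
`[0, 1]`, so a suitable constant contract has gap 1. -/
theorem gapShell_half_nonempty (hE : 0 < E) (hlam : mu < lam)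
    (hc : ∀ a ∈ Icc 0 E, Measurable fun θ => (agent θ).cost a)
    (hp : ∀ a ∈ Icc 0 E, ∀ j, Measurable fun θ => (agent θ).prob a j)
    (h : ∀ θ, (agent θ).IsRegular lam mu L) (hπ0 : ∀ j, 0 ≤ π j) (hπ1 : ∀ j, π j ≤ 1) :
    (gapShell (expectedUtility D agent π) (1 / 2)).Nonempty := by
  have h0 : (0 : ℝ) ∈ Icc (0 : ℝ) 1 := left_mem_Icc.2 zero_le_one
  have hbound := abs_expectedUtility_le (D := D) hE hlam hc hp h hπ0 hπ1
  have hbdd : BddAbove (range (expectedUtility D agent π)) :=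
    ⟨1, by rintro _ ⟨s, rfl⟩; exact (abs_le.1 (hbound s)).2⟩
  have hsup : ⨆ s, expectedUtility D agent π s ≤ 1 := ciSup_le fun s => (abs_le.1 (hbound s)).2
  have hv0 : 0 ≤ expectedUtility D agent π (constContract m h0) := by
    rw [expectedUtility_eq hE hlam hc hp h]
    refine Finset.sum_nonneg fun k _ => mul_nonneg (meanProb_nonneg hE hlam h _ k) ?_
    simpa [constContract, Contract.pay] using hπ0 k
  have hg := le_ciSup hbdd (constContract m h0)
  have hκ : 1 - gap (expectedUtility D agent π) (constContract m h0) ∈ Icc (0 : ℝ) 1 := by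
    rw [gap]; constructor <;> linarith
  have hone : gap (expectedUtility D agent π) (constContract m hκ) = 1 := by
    have := expectedUtility_constContract (D := D) (π := π) hE hlam hc hp h hκ h0
    unfold gap at this ⊢
    linarith
  refine ⟨constContract m hκ, ?_, ?_⟩ <;> rw [hone] <;> norm_num

/-- For a fixed outcome sequence the posted contracts are fixed, so the likelihood is a product of
functions of the separate types and its integral factorizes. -/
theorem expectedRegret_zoomPolicy_eq (hE : 0 < E) (hlam : mu < lam)
    (hc : ∀ a ∈ Icc 0 E, Measurable fun θ => (agent θ).cost a)
    (hp : ∀ a ∈ Icc 0 E, ∀ j, Measurable fun θ => (agent θ).prob a j)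
    (h : ∀ θ, (agent θ).IsRegular lam mu L) (K : ℝ) (T : ℕ) :
    expectedRegret D agent π (zoomPolicy π K T)
      = ∑ y : Fin T → Fin m, zoomProb (contractDist K) (8 * Real.log T)
          (fun s k => π k - s.pay k) (meanProb D agent π) y *
        ∑ t ∈ Finset.range T, gap (expectedUtility D agent π)
          (zoomArm (contractDist K) (8 * Real.log T) (fun s k => π k - s.pay k)
            (extendSeq y) t) := by
  rw [expectedRegret, integral_finsetSum]
  · refine Finset.sum_congr rfl fun y _ => ?_
    rw [integral_mul_const]
    congr 1
    · simp_rw [outcomeProb]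
      rw [integral_fintype_prod_eq_prod (fun (t : Fin T) θ =>
        (agent θ).prob ((agent θ).response π ((zoomPolicy π K T).posted y t)) (y t)),
        zoomProb, Finset.prod_range]
      refine Finset.prod_congr rfl fun t _ => ?_
      rw [zoomPolicy_posted, extendSeq_apply, meanProb]
    · simp_rw [regret, zoomPolicy_posted, gap, Finset.sum_sub_distrib, Finset.sum_const,
        Finset.card_range, nsmul_eq_mul, Finset.sum_range]
  · intro y _
    refine Integrable.mul_const ?_ _
    exact Integrable.fintype_prod (f := fun (t : Fin T) θ =>
      (agent θ).prob ((agent θ).response π ((zoomPolicy π K T).posted y t)) (y t))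
      fun t => integrable_prob_response hE hlam hc hp h _ _

theorem expectedRegret_zoomPolicy_le (hE : 0 < E) (hlam : mu < lam)
    (hc : ∀ a ∈ Icc 0 E, Measurable fun θ => (agent θ).cost a)
    (hp : ∀ a ∈ Icc 0 E, ∀ j, Measurable fun θ => (agent θ).prob a j)
    (h : ∀ θ, (agent θ).IsRegular lam mu L) (hπ0 : ∀ j, 0 ≤ π j) (hπ : Monotone π)
    (hπ1 : ∀ j, π j ≤ 1) {T : ℕ} (hT : 2 ≤ T) {c z : ℝ} (hc0 : 0 < c)
    (hz : z ∈ zoomingExponents (contractDist (lipConst lam mu L))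
      (expectedUtility D agent π) c) :
    expectedRegret D agent π (zoomPolicy π (lipConst lam mu L) T) ≤
      170 * (c * Real.log T) ^ (1 / (z + 2)) * (T : ℝ) ^ ((z + 1) / (z + 2)) := by
  have hbound := abs_expectedUtility_le (D := D) hE hlam hc hp h hπ0 hπ1
  have hbdd : BddAbove (range (expectedUtility D agent π)) :=
    ⟨1, by rintro _ ⟨s, rfl⟩; exact (abs_le.1 (hbound s)).2⟩
  have hsup : ⨆ s, expectedUtility D agent π s ≤ 1 := ciSup_le fun s => (abs_le.1 (hbound s)).2
  have hgap : ∀ s, gap (expectedUtility D agent π) s ≤ 2 := fun s => by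
    rw [gap]; linarith [(abs_le.1 (hbound s)).1]
  have hz0 : 0 ≤ z := hz.1
  have hT' : (2 : ℝ) ≤ T := by exact_mod_cast hT
  have hlog : 1 / 2 ≤ Real.log T := by
    linarith [Real.log_le_log (by norm_num) hT', Real.log_two_gt_d9]
  have hlog0 : 0 < Real.log T := by linarith
  have hcl : 0 < c * Real.log T := mul_pos hc0 hlog0
  set δ : ℝ := (c * Real.log T / T) ^ (1 / (z + 2)) with hδdef
  have hδ : 0 < δ := Real.rpow_pos_of_pos (by positivity) _
  set Q : ℝ := (c * Real.log T) ^ (1 / (z + 2)) * (T : ℝ) ^ ((z + 1) / (z + 2)) with hQ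
  have hδT : δ * T = Q := by
    rw [hδdef, hQ, Real.div_rpow hcl.le (by positivity), div_mul_eq_mul_div, mul_div_assoc]
    congr 1
    have h1 : (z + 1) / (z + 2) = 1 - 1 / (z + 2) := by field_simp; ring
    rw [h1, Real.rpow_sub (by linarith), Real.rpow_one]
  have hδpow : δ ^ (z + 2) = c * Real.log T / T := by
    rw [hδdef, ← Real.rpow_mul (by positivity), one_div_mul_cancel (by positivity), Real.rpow_one]
  have hmain : c * Real.log T * δ ^ (-(z + 1)) = Q := by
    have h1 : c * Real.log T = δ ^ (z + 2) * T := by rw [hδpow]; field_simp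
    rw [h1, mul_right_comm, ← Real.rpow_add hδ, ← hδT,
      show z + 2 + -(z + 1) = 1 by ring, Real.rpow_one]
  -- The shell at `r = 1 / 2` is nonempty, so covering it takes at least one set.
  have hchalf : 1 ≤ c * 2 ^ z := by
    obtain ⟨n, hn, U, hU, -⟩ := hz.2 (1 / 2) ⟨by norm_num, by norm_num⟩
    obtain ⟨s, hs⟩ := gapShell_half_nonempty (D := D) hE hlam hc hp h hπ0 hπ1
    obtain ⟨i, -⟩ := mem_iUnion.1 (hU hs)
    have h1 : (1 : ℝ) ≤ n := by exact_mod_cast i.pos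
    rw [one_div, Real.inv_rpow (by norm_num), Real.rpow_neg (by norm_num), inv_inv] at hn
    linarith
  -- Hence the additive 4 is at most `8 * Q`, and `2 + 160 + 8 = 170` is the final constant.
  have hQhalf : 1 / 2 ≤ Q := by
    have h1 : (1 / 2 : ℝ) ^ (z + 2) ≤ c * Real.log T := by
      have h2 : (1 / 2 : ℝ) ^ (z + 2) = (2 ^ z)⁻¹ * (1 / 4) := by
        rw [Real.rpow_add (by norm_num), one_div, Real.inv_rpow (by norm_num)]
        norm_num
      have h3 : ((2 : ℝ) ^ z)⁻¹ ≤ c := by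
        rw [inv_le_iff_one_le_mul₀ (by positivity)]; exact hchalf
      rw [h2]
      exact mul_le_mul h3 (by linarith) (by norm_num) hc0.le
    have h4 : 1 / 2 ≤ (c * Real.log T) ^ (1 / (z + 2)) := by
      calc (1 / 2 : ℝ) = ((1 / 2 : ℝ) ^ (z + 2)) ^ (1 / (z + 2)) := by
            rw [← Real.rpow_mul (by norm_num), mul_one_div_cancel (by positivity), Real.rpow_one]
        _ ≤ _ := Real.rpow_le_rpow (by positivity) h1 (by positivity)
    have h5 : 1 ≤ (T : ℝ) ^ ((z + 1) / (z + 2)) :=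
      Real.one_le_rpow (by linarith) (by positivity)
    rw [hQ]
    nlinarith
  have key := sum_zoomProb_mul_sum_gap_le (X := Contract m) (Y := Fin m)
    (D := contractDist (lipConst lam mu L)) (rew := fun s k => π k - s.pay k)
    (q := meanProb D agent π) (v := expectedUtility D agent π)
    (fun s k => meanProb_nonneg hE hlam h s k) (sum_meanProb hE hlam hc hp h)
    (abs_reward_le hπ0 hπ1) (expectedUtility_eq hE hlam hc hp h) hbdd
    (fun s => by simp [contractDist])
    (expectedUtility_sub_le hE hlam hc hp h hπ0 hπ hπ1) hgap hT rfl hc0 hz hδ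
  rw [expectedRegret_zoomPolicy_eq hE hlam hc hp h]
  refine key.trans ?_
  have : 2 * δ * T + 20 * (8 * Real.log T) * c * δ ^ (-(z + 1)) + 4
      = 2 * (δ * T) + 160 * (c * Real.log T * δ ^ (-(z + 1))) + 4 := by ring
  rw [this, hδT, hmain, mul_assoc, ← hQ]
  linarith

end Bandit

end ContractDesign

end

theorem mainTheorem10 :
    ∃ C : ℝ, 0 < C ∧
      ∀ (m : ℕ) [NeZero m] (π : Fin m → ℝ) (E lam mu L : ℝ) (T : ℕ),
        π 0 = 0 → StrictMono π → (∀ j, π j ≤ 1) → 0 < E → mu < lam → 2 ≤ T →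
        ∃ P : Policy m T,
          ∀ (Θ : Type*) [MeasurableSpace Θ] (D : Measure Θ) [IsProbabilityMeasure D]
            (agent : Θ → AgentType m E),
            (∀ a ∈ Icc 0 E, Measurable fun θ => (agent θ).cost a) →
            (∀ a ∈ Icc 0 E, ∀ j, Measurable fun θ => (agent θ).prob a j) →
            (∀ θ, (agent θ).IsRegular lam mu L) →
            (∀ s, Integrable (fun θ => (agent θ).principalUtility π s) D) ∧
            (∀ s s', |expectedUtility D agent π s - expectedUtility D agent π s'| ≤
              contractDist (lipConst lam mu L) s s') ∧
            (∃ c > 0, (zoomingExponents (contractDist (lipConst lam mu L))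
              (expectedUtility D agent π) c).Nonempty) ∧
            ∀ c > 0, (zoomingExponents (contractDist (lipConst lam mu L))
                (expectedUtility D agent π) c).Nonempty →
              ∀ z, z = zoomingDim (contractDist (lipConst lam mu L))
                  (expectedUtility D agent π) c →
                expectedRegret D agent π P ≤
                  C * (c * Real.log T) ^ (1 / (z + 2)) * (T : ℝ) ^ ((z + 1) / (z + 2)) := by
  refine ⟨170, by norm_num, ?_⟩
  intro m _ π E lam mu L T hπ0 hπ hπ1 hE hlam hT
  refine ⟨zoomPolicy π (lipConst lam mu L) T, ?_⟩
  intro Θ _ D _ agent hc hp h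
  have hπ0' : ∀ j, 0 ≤ π j := fun j => by rw [← hπ0]; exact hπ.monotone (Fin.zero_le j)
  refine ⟨integrable_principalUtility hE hlam hc hp h,
    expectedUtility_sub_le hE hlam hc hp h hπ0' hπ.monotone hπ1,
    exists_zoomingExponents_nonempty (two_le_lipConst hlam L) _, ?_⟩
  rintro c hc0 hne z rfl
  exact expectedRegret_zoomPolicy_le hE hlam hc hp h hπ0' hπ.monotone hπ1 hT hc0
    (zoomingDim_mem_zoomingExponents hne)
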